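/- **Logic programs.** A rule $H\leftarrow B$ over a set of atoms has a set of literals $B$ as body and a head $H$ that is an atom $p$ (normal rule), $\{p\}$ (choice rule, read as $p\vee\neg p$) or $\bot$ (integrity constraint). A logic program $P$ is a set of rules, read as the conjunction of the implications $B\to H$. A set of atoms $X$ is a stable model of $P$ if it is a subset-minimal model of the formula obtained from $P$ by replacing each literal not satisfied by $X$ by $\bot$; $SM(P)$ is the set of stable models. $P$ is in GDT form if no cycle of its dependency graph contains a negative edge and every choice rule is of the form $\{p\}\leftarrow$ with $p$ not in the head of any other rule. For sets $Y\subseteq X$ of atoms let $fix(Y,X)=\{\bot\leftarrow\neg x\mid x\in Y\}\cup\{\bot\leftarrow x\mid x\in X\setminus Y\}$. A quantified logic program (QLP) $\exists X\,\mathcal Q P$ ($\forall X\,\mathcal Q P$) is satisfiable if $\mathcal Q(P\cup fix(Y,X))$ is satisfiable for some (all) $Y\subseteq X$; with an empty prefix, $P$ is satisfiable if it has a stable model. **Planning problems.** Let $F$ be a finite set of fluents, $A=A_n\cup A_s$ the disjoint union of the sets of normal and of sensing actions; $a^f\in A_s$ observes the fluent $f$. States are subsets of $F$. A planning problem is a triple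 $\langle\Phi,I,G\rangle$ with $\Phi:\mathcal P(F)\times A\to\mathcal P(F)\cup\{\bot\}$ and non-empty sets $I,G\subseteq\mathcal P(F)$. Plans are $[]$ (length $0$), $[a;p]$ with $a\in A_n$ (length $1+|p|$), and $[a^f;(p_f,p_{\bar f})]$ with $a^f\in A_s$ (length $1+\max(|p_f|,|p_{\bar f}|)$). For a set $S$ of states, $\Phi(S,a)=\bot$ if $\Phi(s,a)=\bot$ for some $s\in S$, and $\Phi(S,a)=\{\Phi(s,a)\mid s\in S\}$ otherwise; $\Phi(S,[])=S$; $\Phi(S,[a;p])=\Phi(\Phi(S,a),p)$; $\Phi(S,[a^f;(p_f,p_{\bar f})])=\Phi(S^f,p_f)\cup\Phi(S^{\bar f},p_{\bar f})$, where $S^f$, $S^{\bar f}$ consist of the states in $\Phi(S,a^f)$ that contain, respectively do not contain, $f$; the result is $\bot$ whenever a part is $\bot$. A plan $p$ solves the problem if $\Phi(I,p)\ne\bot$ and $\Phi(I,p)\subseteq G$. **Planning descriptions.** Let $F'=\{f'\mid f\in F\}$ be a disjoint copy of $F$, and $s'=\{f'\mid f\in s\}$. A planning description $D=\langle DR,IR,GR\rangle$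 consists of dynamic rules (head atoms in $F$, body atoms in $A\cup F\cup F'$), initial rules (over $F$) and goal rules (integrity constraints over $F$). It represents $\langle\Phi,I,G\rangle$ if: $s'\cup\{a\leftarrow\}\cup DR$ has at most one stable model for all $s\subseteq F$, $a\in A$ (deterministic); $SM(s'\cup DR)=\{s'\cup s\}$ for all $s\subseteq F$ (inertial); $\Phi(s,a)=M\cap F$ if $s'\cup\{a\leftarrow\}\cup DR$ has a single stable model $M$, and $\Phi(s,a)=\bot$ otherwise; $I=SM(IR)$; and $G=SM(\{\{f\}\leftarrow\,\mid f\in F\}\cup GR)$. **Encoding.** For $n\ge1$ let $\Pi_n$ be the union of the following rules. 1. The facts $t(T)$ for $1\le T\le n$, $action(a)$ for $a\in A$, and $senses(a^f,f)$ for $a^f\in A_s$. 2. The rules $IR$ with $f$ replaced by $h(f,0)$, and with $\bot$ in heads replaced by $\alpha(0)$. 3. For $1\le T\le n$, the rules $DR$ with $f$, $f'$, $a$ replaced by $h(f,T)$, $h(f,T-1)$, $occ(a,T)$, and with $t(T)$ and $\neg\alpha(T)$ added to the bodies. 4. The rules $GR$ with $f$ replaced by $h(f,n)$ and with $\neg\alpha(n)$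 added to the bodies. 5. For $1\le T\le n$ and all $a\in A$, $f\in F$, the rules $$\{occ(b,T):b\in A\}\le1\leftarrow t(T)$$ $$\alpha(T)\leftarrow t(T),\alpha(T-1)$$ $$\{obs(true,T)\}\leftarrow t(T)\quad(\text{only for }T<n)$$ $$\alpha(T)\leftarrow t(T),occ(a,T-1),senses(a,f),\{h(f,T-1),obs(true,T-1)\}=1$$ $$\alpha(T)\leftarrow t(T),occ(a,T),\{senses(a,g):g\in F\}=0,obs(true,T)$$ The first one chooses at most one action for time $T$; the condition $\{\ldots\}=k$ in a body says that exactly $k$ of the listed atoms are true. Let $Occ_T=\{occ(a,T)\mid a\in A\}$, $Obs_T=\{obs(true,T)\}$, and let $Open$ be the set of the atoms $h(f,0)$ with $\{f\}\leftarrow$ in $IR$. **Theorem.** Let $D$ be a planning description over a finite set of fluents that represents a planning problem with sensing actions $\langle\Phi,I,G\rangle$, such that its initial rules are in GDT form, and let $n$ be a positive integer. There is a plan of length at most $n$ that solves the problem if and only if the QLP $$\exists Occ_1\forall Obs_1\ldots\exists Occ_{n-1}\forall Obs_{n-1}\exists Occ_n\forall Open\;\Pi_n$$ is satisfiable. -/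

import Mathlib

/-! ## Logic programs with choice rules and integrity constraints -/

namespace ASP

universe u v

/-- Literals over a set of atoms `α`. -/
inductive Literal (α : Type u) : Type u
  | pos (p : α) : Literal α
  | neg (p : α) : Literal α

/-- Rule heads: an atom `p` (normal rule), `{p}` (choice rule), or `⊥` (integrity constraint). -/
inductive Head (α : Type u) : Type u
  | atom (p : α) : Head α
  | choice (p : α) : Head α
  | bot : Head α

/-- A rule `head ← body`, where the body is a set of literals. -/
structure Rule (α : Type u) : Type u where
  head : Head α
  body : Set (Literal α)

/-- A logic program is a set of rules. -/
abbrev Program (α : Type u) : Type u := Set (Rule α)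

/-- Satisfaction of a literal by a set of atoms. -/
def Literal.Holds {α : Type u} (X : Set α) : Literal α → Prop
  | .pos p => p ∈ X
  | .neg p => p ∉ X

/-- `Y` satisfies the result of replacing the literal `l` by `⊥` if `l` is not satisfied by `X`. -/
def Literal.HoldsReduct {α : Type u} (X Y : Set α) (l : Literal α) : Prop :=
  l.Holds X ∧ l.Holds Y

/-- The same for heads; the head `{p}` stands for the formula `p ∨ ¬ p`. -/
def Head.HoldsReduct {α : Type u} (X Y : Set α) : Head α → Prop
  | .atom p => (Literal.pos p).HoldsReduct X Y
  | .choice p => (Literal.pos p).HoldsReduct X Y ∨ (Literal.neg p).HoldsReduct X Y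
  | .bot => False

/-- `Y` is a model of the formula that results from replacing in the program `P` (read as a
conjunction of implications `body → head`) every literal not satisfied by `X` by `⊥`. -/
def Program.ReductModel {α : Type u} (P : Program α) (X Y : Set α) : Prop :=
  ∀ r ∈ P, (∀ l ∈ r.body, l.HoldsReduct X Y) → r.head.HoldsReduct X Y

/-- `X` is a stable model of `P`: a subset-minimal model of the reduct of `P` by `X`. -/
def Program.IsStable {α : Type u} (P : Program α) (X : Set α) : Prop :=
  Minimal (fun Y : Set α => P.ReductModel X Y) X

/-- The set of stable models of `P`. -/
def Program.SM {α : Type u} (P : Program α) : Set (Set α) := {X | P.IsStable X}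

/-- The fact `p ←`. -/
def fact {α : Type u} (p : α) : Rule α := ⟨.atom p, ∅⟩

/-- The facts `p ←` for `p ∈ X`. -/
def facts {α : Type u} (X : Set α) : Program α := fact '' X

/-- The atom `p` occurs in the head. -/
def Head.Mentions {α : Type u} (p : α) : Head α → Prop
  | .atom q => q = p
  | .choice q => q = p
  | .bot => False

/-- Positive edge from `p` to `q` in the dependency graph. -/
def Program.PosEdge {α : Type u} (P : Program α) (p q : α) : Prop :=
  ∃ r ∈ P, r.head.Mentions q ∧ Literal.pos p ∈ r.body

/-- Negative edge from `p` to `q` in the dependency graph. -/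
def Program.NegEdge {α : Type u} (P : Program α) (p q : α) : Prop :=
  ∃ r ∈ P, r.head.Mentions q ∧ Literal.neg p ∈ r.body

/-- No cycle of the dependency graph involves a negative edge. -/
def Program.Stratified {α : Type u} (P : Program α) : Prop :=
  ∀ p q : α, P.NegEdge p q →
    ¬ Relation.ReflTransGen (fun a b => P.PosEdge a b ∨ P.NegEdge a b) q p

/-- Generate-define-test form: the program is stratified, and each of its choice rules is of the
form `{p} ←` where `p` does not occur in the head of any other rule. -/
def Program.IsGDT {α : Type u} (P : Program α) : Prop :=
  P.Stratified ∧
    ∀ r ∈ P, ∀ p : α, r.head = .choice p →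
      r.body = ∅ ∧ ∀ r' ∈ P, r'.head.Mentions p → r' = r

/-! ### Renaming of atoms and modification of rules -/

def Literal.map {α : Type u} {β : Type v} (g : α → β) : Literal α → Literal β
  | .pos p => .pos (g p)
  | .neg p => .neg (g p)

def Head.map {α : Type u} {β : Type v} (g : α → β) : Head α → Head β
  | .atom p => .atom (g p)
  | .choice p => .choice (g p)
  | .bot => .bot

def Rule.map {α : Type u} {β : Type v} (g : α → β) (r : Rule α) : Rule β :=
  ⟨r.head.map g, Literal.map g '' r.body⟩

/-- Add a literal to the body of a rule. -/
def Rule.addLit {α : Type u} (l : Literal α) (r : Rule α) : Rule α :=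
  ⟨r.head, insert l r.body⟩

/-- Replace `⊥` in the head by the atom `p`. -/
def Head.replaceBot {α : Type u} (p : α) : Head α → Head α
  | .bot => .atom p
  | h => h

def Rule.replaceBot {α : Type u} (p : α) (r : Rule α) : Rule α :=
  ⟨r.head.replaceBot p, r.body⟩

/-! ## Quantified logic programs -/

/-- The constraints selecting the stable models whose intersection with `Y` is `X`. -/
def fixcons {α : Type u} (X Y : Set α) : Program α :=
  {r | ∃ x ∈ X, r = ⟨.bot, {Literal.neg x}⟩} ∪ {r | ∃ x ∈ Y \ X, r = ⟨.bot, {Literal.pos x}⟩}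

inductive Quantifier : Type
  | ex : Quantifier
  | all : Quantifier

/-- Satisfiability of the quantified logic program `Q₀ X₀ … Qₘ Xₘ P`; the prefix is a list, and
with an empty prefix this is satisfiability of `P`, i.e. existence of a stable model. -/
def QSat {α : Type u} : List (Quantifier × Set α) → Program α → Prop
  | [], P => ∃ M : Set α, P.IsStable M
  | (.ex, X) :: Q, P => ∃ Y : Set α, Y ⊆ X ∧ QSat Q (P ∪ fixcons Y X)
  | (.all, X) :: Q, P => ∀ Y : Set α, Y ⊆ X → QSat Q (P ∪ fixcons Y X)

end ASP

/-! ## Planning problems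

`F` is the set of fluents, `N` the set of normal actions, and `S` the set of sensing actions;
`sensed : S → F` assigns to a sensing action the fluent that it observes. The set of all actions
is `N ⊕ S`, and a state is a set of fluents. -/

namespace Planning

open ASP

universe u v w

/-- Transition functions; `none` is `⊥`, i.e. the action is not executable. -/
abbrev Transition (F : Type u) (N : Type v) (S : Type w) : Type (max u v w) :=
  Set F → N ⊕ S → Option (Set F)

/-- A planning problem: a transition function and non-empty sets of initial and goal states. -/
structure Problem (F : Type u) (N : Type v) (S : Type w) : Type (max u v w) where
  trans : Transition F N S
  init : Set (Set F)
  goal : Set (Set F)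
  init_nonempty : init.Nonempty
  goal_nonempty : goal.Nonempty

/-- Conditional plans: `[]`, `[a; p]` for a normal action `a`, and `[a; (p, q)]` for a sensing
action `a`, where `p` is for the case that the sensed fluent is true and `q` for the other. -/
inductive Plan (N : Type v) (S : Type w) : Type (max v w)
  | nil : Plan N S
  | act (a : N) (p : Plan N S) : Plan N S
  | sense (a : S) (p q : Plan N S) : Plan N S

def Plan.length {N : Type v} {S : Type w} : Plan N S → ℕ
  | .nil => 0
  | .act _ p => 1 + p.length
  | .sense _ p q => 1 + max p.length q.length

open Classical in
/-- The transition function on a set of states. -/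
noncomputable def stepSet {F : Type u} {N : Type v} {S : Type w} (Φ : Transition F N S)
    (X : Set (Set F)) (a : N ⊕ S) : Option (Set (Set F)) :=
  if ∃ s ∈ X, Φ s a = none then none else some {s' | ∃ s ∈ X, Φ s a = some s'}

/-- The transition function on a plan and a set of states. -/
noncomputable def runPlan {F : Type u} {N : Type v} {S : Type w} (sensed : S → F)
    (Φ : Transition F N S) : Plan N S → Set (Set F) → Option (Set (Set F))
  | .nil, X => some X
  | .act a q, X =>
    match stepSet Φ X (.inl a) with
    | none => none
    | some Y => runPlan sensed Φ q Y
  | .sense a q q', X =>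
    match stepSet Φ X (.inr a) with
    | none => none
    | some Y =>
      match runPlan sensed Φ q {s ∈ Y | sensed a ∈ s},
          runPlan sensed Φ q' {s ∈ Y | sensed a ∉ s} with
      | some Z, some Z' => some (Z ∪ Z')
      | _, _ => none

/-- The plan `p` is a solution to the planning problem. -/
def Problem.Solves {F : Type u} {N : Type v} {S : Type w} (sensed : S → F)
    (PP : Problem F N S) (p : Plan N S) : Prop :=
  ∃ Z : Set (Set F), runPlan sensed PP.trans p PP.init = some Z ∧ Z ⊆ PP.goal

/-! ## Planning descriptions -/

/-- Atoms of dynamic rules: `f ∈ F`, the previous-situation copy `f'`, and actions. -/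
inductive DynAtom (F : Type u) (N : Type v) (S : Type w) : Type (max u v w)
  | fluent (f : F) : DynAtom F N S
  | prev (f : F) : DynAtom F N S
  | action (a : N ⊕ S) : DynAtom F N S

/-- A planning description: dynamic rules (head atoms are fluents), initial rules, and goal rules
(integrity constraints). -/
structure Description (F : Type u) (N : Type v) (S : Type w) : Type (max u v w) where
  dyn : Program (DynAtom F N S)
  init : Program F
  goal : Program F
  dyn_head : ∀ r ∈ dyn, ∀ p : DynAtom F N S, r.head.Mentions p → ∃ f : F, p = .fluent f
  goal_head : ∀ r ∈ goal, r.head = .bot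

/-- The set of atoms `s' = {f' | f ∈ s}`. -/
def prevState {F : Type u} {N : Type v} {S : Type w} (s : Set F) : Set (DynAtom F N S) :=
  DynAtom.prev '' s

/-- The program `s' ∪ {a ←} ∪ DR`. -/
def stepProgram {F : Type u} {N : Type v} {S : Type w} (DR : Program (DynAtom F N S))
    (s : Set F) (a : N ⊕ S) : Program (DynAtom F N S) :=
  facts (prevState s) ∪ {fact (.action a)} ∪ DR

/-- Every program `s' ∪ {a ←} ∪ DR` has zero or one stable model. -/
def Deterministic {F : Type u} {N : Type v} {S : Type w} (DR : Program (DynAtom F N S)) : Prop :=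
  ∀ (s : Set F) (a : N ⊕ S), (stepProgram DR s a).SM.Subsingleton

/-- If no action occurs then the state persists: the only stable model of `s' ∪ DR` is
`s' ∪ s`. -/
def Inertial {F : Type u} {N : Type v} {S : Type w} (DR : Program (DynAtom F N S)) : Prop :=
  ∀ s : Set F,
    (facts (prevState s) ∪ DR : Program (DynAtom F N S)).SM = {prevState s ∪ DynAtom.fluent '' s}

open Classical in
/-- The transition function defined by a set of dynamic rules. -/
noncomputable def dynTrans {F : Type u} {N : Type v} {S : Type w}
    (DR : Program (DynAtom F N S)) : Transition F N S := fun s a =>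
  if h : ∃! M : Set (DynAtom F N S), (stepProgram DR s a).IsStable M then
    some {f : F | DynAtom.fluent f ∈ h.choose}
  else none

/-- The choice rules `{p} ←` for `p ∈ X`. -/
def choices {α : Type u} (X : Set α) : Program α := {r | ∃ p ∈ X, r = ⟨.choice p, ∅⟩}

/-- The description is deterministic and inertial, and its dynamic, initial and goal rules define
the transition function, the initial states and the goal states of the problem. -/
def Description.Represents {F : Type u} {N : Type v} {S : Type w} (D : Description F N S)
    (PP : Problem F N S) : Prop :=
  Deterministic D.dyn ∧ Inertial D.dyn ∧
    PP.trans = dynTrans D.dyn ∧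
    PP.init = D.init.SM ∧
    PP.goal = (choices Set.univ ∪ D.goal : Program F).SM

/-! ## The encoding

Ground programs for horizon `n`. The variable `T` of the non-ground rules is always guarded by
`t(T)`, so that only its instances `1, …, n` are written out. -/

/-- Atoms of the encoding; `obs T` is `obs(true, T)` and `flag T` is `α(T)`. -/
inductive EncAtom (F : Type u) (N : Type v) (S : Type w) : Type (max u v w)
  | t (T : ℕ) : EncAtom F N S
  | action (a : N ⊕ S) : EncAtom F N S
  | senses (a : N ⊕ S) (f : F) : EncAtom F N S
  | occ (a : N ⊕ S) (T : ℕ) : EncAtom F N S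
  | h (f : F) (T : ℕ) : EncAtom F N S
  | obs (T : ℕ) : EncAtom F N S
  | flag (T : ℕ) : EncAtom F N S

/-- The facts `t(T)` for `1 ≤ T ≤ n`, `action(a)` for every action, and `senses(a, f)` for every
sensing action `a` observing `f`. -/
def domainFacts {F : Type u} {N : Type v} {S : Type w} (sensed : S → F) (n : ℕ) :
    Program (EncAtom F N S) :=
  facts ({p | ∃ T : ℕ, 1 ≤ T ∧ T ≤ n ∧ p = .t T} ∪ {p | ∃ a : N ⊕ S, p = .action a} ∪
    {p | ∃ a : S, p = .senses (.inr a) (sensed a)})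

/-- The initial rules with every `f` replaced by `h(f, 0)`. -/
def encInit {F : Type u} {N : Type v} {S : Type w} (D : Description F N S) :
    Program (EncAtom F N S) :=
  Rule.map (fun f => EncAtom.h f 0) '' D.init

/-- The initial rules, where in addition `⊥` in the head of the integrity constraints is replaced
by `α(0)`. -/
def encInitFlag {F : Type u} {N : Type v} {S : Type w} (D : Description F N S) :
    Program (EncAtom F N S) :=
  Rule.replaceBot (.flag 0) '' encInit D

/-- The atoms `f`, `f'`, `a` are replaced by `h(f, T)`, `h(f, T - 1)`, `occ(a, T)`. -/
def dynAtomAt {F : Type u} {N : Type v} {S : Type w} (T : ℕ) : DynAtom F N S → EncAtom F N S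
  | .fluent f => .h f T
  | .prev f => .h f (T - 1)
  | .action a => .occ a T

/-- The dynamic rules at time steps `1, …, n`, with `t(T)` and `not α(T)` added to the bodies. -/
def encDynFlag {F : Type u} {N : Type v} {S : Type w} (D : Description F N S) (n : ℕ) :
    Program (EncAtom F N S) :=
  {r | ∃ T : ℕ, 1 ≤ T ∧ T ≤ n ∧ ∃ d ∈ D.dyn,
    r = ((d.map (dynAtomAt T)).addLit (.pos (.t T))).addLit (.neg (.flag T))}

/-- The goal rules with every `f` replaced by `h(f, n)`, and `not α(n)` added to the bodies. -/
def encGoalFlag {F : Type u} {N : Type v} {S : Type w} (D : Description F N S) (n : ℕ) :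
    Program (EncAtom F N S) :=
  (fun g : Rule F => (g.map (fun f => EncAtom.h f n)).addLit (.neg (.flag n))) '' D.goal

/-- At most one action at every time step, `{occ(A, T) : action(A)} ≤ 1 ← t(T)`: choice rules for
the atoms `occ(a, T)`, and constraints excluding that two of them are true. -/
def generateLE {F : Type u} {N : Type v} {S : Type w} (n : ℕ) : Program (EncAtom F N S) :=
  {r | ∃ T : ℕ, 1 ≤ T ∧ T ≤ n ∧ ∃ a : N ⊕ S,
    r = ⟨.choice (.occ a T), {.pos (.t T), .pos (.action a)}⟩} ∪
  {r | ∃ T : ℕ, 1 ≤ T ∧ T ≤ n ∧ ∃ a b : N ⊕ S, a ≠ b ∧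
    r = ⟨.bot, {.pos (.t T), .pos (.action a), .pos (.action b),
      .pos (.occ a T), .pos (.occ b T)}⟩}

/-- `α(T) ← t(T), α(T - 1)`. -/
def flagRules {F : Type u} {N : Type v} {S : Type w} (n : ℕ) : Program (EncAtom F N S) :=
  {r | ∃ T : ℕ, 1 ≤ T ∧ T ≤ n ∧
    r = ⟨.atom (.flag T), {.pos (.t T), .pos (.flag (T - 1))}⟩}

/-- `{obs(true, T)} ← t(T), T < n`. -/
def obsRules {F : Type u} {N : Type v} {S : Type w} (n : ℕ) : Program (EncAtom F N S) :=
  {r | ∃ T : ℕ, 1 ≤ T ∧ T < n ∧ r = ⟨.choice (.obs T), {.pos (.t T)}⟩}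

/-- `α(T) ← t(T), occ(A, T-1), senses(A, F), {h(F, T-1), obs(true, T-1)} = 1`; the cardinality
constraint says that exactly one of its two atoms is true, which gives two rules. -/
def mismatchRules {F : Type u} {N : Type v} {S : Type w} (n : ℕ) : Program (EncAtom F N S) :=
  {r | ∃ T : ℕ, 1 ≤ T ∧ T ≤ n ∧ ∃ (a : N ⊕ S) (f : F),
    r = ⟨.atom (.flag T), {.pos (.t T), .pos (.occ a (T - 1)), .pos (.senses a f),
      .pos (.h f (T - 1)), .neg (.obs (T - 1))}⟩} ∪
  {r | ∃ T : ℕ, 1 ≤ T ∧ T ≤ n ∧ ∃ (a : N ⊕ S) (f : F),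
    r = ⟨.atom (.flag T), {.pos (.t T), .pos (.occ a (T - 1)), .pos (.senses a f),
      .neg (.h f (T - 1)), .pos (.obs (T - 1))}⟩}

/-- `α(T) ← t(T), occ(A, T), {senses(A, F)} = 0, obs(true, T)`; the cardinality constraint says
that `senses(A, f)` is false for all `f`. -/
def nonsensingRules {F : Type u} {N : Type v} {S : Type w} (n : ℕ) : Program (EncAtom F N S) :=
  {r | ∃ T : ℕ, 1 ≤ T ∧ T ≤ n ∧ ∃ a : N ⊕ S,
    r = ⟨.atom (.flag T), {.pos (.t T), .pos (.occ a T), .pos (.obs T)} ∪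
      {l | ∃ f : F, l = .neg (.senses a f)}⟩}

/-- The logic program for conditional planning with horizon `n`. -/
def condProgram {F : Type u} {N : Type v} {S : Type w} (sensed : S → F) (D : Description F N S)
    (n : ℕ) : Program (EncAtom F N S) :=
  domainFacts sensed n ∪ (encInitFlag D ∪ encDynFlag D n ∪ encGoalFlag D n) ∪
    generateLE n ∪ flagRules n ∪ obsRules n ∪ mismatchRules n ∪ nonsensingRules n

/-- `Occ_T = {occ(a, T) | a ∈ A}`. -/
def occSet {F : Type u} {N : Type v} {S : Type w} (T : ℕ) : Set (EncAtom F N S) :=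
  {p | ∃ a : N ⊕ S, p = .occ a T}

/-- `Obs_T = {obs(true, T)}`. -/
def obsSet {F : Type u} {N : Type v} {S : Type w} (T : ℕ) : Set (EncAtom F N S) := {.obs T}

/-- `Open`: the atoms `h(f, 0)` for which `{h(f, 0)} ←` is one of the encoded initial rules. -/
def openSet {F : Type u} {N : Type v} {S : Type w} (D : Description F N S) :
    Set (EncAtom F N S) :=
  {p | ∃ f : F, p = .h f 0 ∧ (⟨.choice (.h f 0), ∅⟩ : Rule (EncAtom F N S)) ∈ encInit D}

/-- The prefix `∃Occ₁ ∀Obs₁ … ∃Occ_{n-1} ∀Obs_{n-1} ∃Occ_n ∀Open` (for `n ≥ 1`). -/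
def condPrefix {F : Type u} {N : Type v} {S : Type w} (D : Description F N S) (n : ℕ) :
    List (Quantifier × Set (EncAtom F N S)) :=
  (List.range (n - 1)).flatMap
      (fun i => [(Quantifier.ex, occSet (i + 1)), (Quantifier.all, obsSet (i + 1))]) ++
    [(Quantifier.ex, occSet n), (Quantifier.all, openSet D)]

end Planning

/-!
The prefix of the quantified program describes a game: at each time the existential player chooses
actions and the universal player announces an observation, and at the end the universal player
chooses an initial state. The theorem holds because stable models of the encoding are exactly the
trajectories of the planning domain for these choices, and strategies of the existential player are
exactly conditional plans.

*Stable models.* A set of atoms is a stable model if and only if it consists of the atoms that are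
derivable by forward chaining when choices and negative literals are evaluated in the set itself,
and violates no integrity constraint (`ASP.isStable_iff`). Constraints added by quantifiers
therefore only select stable models (`ASP.isStable_union_fixcons`). A program in
generate-define-test form has exactly one such set of derivable atoms for each choice among its open
atoms (`ASP.Program.IsGDT.existsUnique`), so that quantifying over the open atoms amounts to
quantifying over the initial states and some sets that violate initial constraints. The latter
raise the flag `α(0)`.

*Trajectories.* The encoding is layered by time. `Planning.isClosed_condProgram_iff` describes its
sets of derivable atoms layer by layer: as long as the flag is not raised, the layer of time `T` is
a stable model of the dynamic rules for the state and the actions given by the other atoms. Once the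
flag is raised, the dynamic rules and the goal rules are disabled, and a stable model exists for
trivial reasons. Hence there is a stable model if and only if the chosen actions lead from the
initial state to the goal unless an announced observation is wrong, or true without a sensing action
(`Planning.Run`, `Planning.exists_isStable_iff`).

*Plans.* The quantifier prefix is unfolded into the game in `Planning.qsat_iff_game`, and
`Planning.game_wins_iff` turns winning strategies into plans and conversely, by induction on the
number of remaining steps and for an arbitrary set of states that are still possible. Choosing no
action preserves the state since the description is inertial, which accounts for plans that are
shorter than the horizon. Since transitions are deterministic, the set of possible states evolves
in the game as under the execution of a plan.
-/

/-! ### Stable models as supported sets of derivable atoms -/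

namespace ASP

universe u v

/-- The atoms obtained from the rules of `P` by forward chaining, where a choice rule for `p` may
be applied if `p ∈ C`, and negative literals are evaluated in the fixed set `Z`. For `C = Z = X`
this is the least model of the reduct by `X`. -/
inductive Derives {α : Type u} (P : Program α) (C Z : Set α) : α → Prop
  | intro (r : Rule α) (hr : r ∈ P) (p : α)
      (hp : r.head = .atom p ∨ r.head = .choice p ∧ p ∈ C)
      (hpos : ∀ q, Literal.pos q ∈ r.body → Derives P C Z q)
      (hneg : ∀ q, Literal.neg q ∈ r.body → q ∉ Z) : Derives P C Z p

/-- `X` satisfies the body of some integrity constraint of `P`. -/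
def Program.Violated {α : Type u} (P : Program α) (X : Set α) : Prop :=
  ∃ r ∈ P, r.head = .bot ∧ ∀ l ∈ r.body, l.Holds X

/-- `X` consists of the derivable atoms, with choices and negative literals evaluated in `X`
itself; such a set is a stable model as soon as it satisfies the integrity constraints. -/
def Program.IsClosed {α : Type u} (P : Program α) (X : Set α) : Prop :=
  ∀ p, p ∈ X ↔ Derives P X X p

theorem holds_body {α : Type u} {B : Set (Literal α)} {X : Set α}
    (hpos : ∀ q, Literal.pos q ∈ B → q ∈ X) (hneg : ∀ q, Literal.neg q ∈ B → q ∉ X) :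
    ∀ l ∈ B, l.Holds X := by
  rintro (q | q) hl
  · exact hpos q hl
  · exact hneg q hl

theorem isStable_iff {α : Type u} {P : Program α} {X : Set α} :
    P.IsStable X ↔ P.IsClosed X ∧ ¬ P.Violated X := by
  constructor
  · rintro ⟨hX, hmin⟩
    have hbody : ∀ B : Set (Literal α), (∀ l ∈ B, l.Holds X) → ∀ l ∈ B, l.HoldsReduct X X :=
      fun B h l hl => ⟨h l hl, h l hl⟩
    have hder : ∀ p, Derives P X X p → p ∈ X := by
      intro p hp
      induction hp with
      | intro r hr p hp hpos hneg ih =>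
        rcases hp with hp | hp
        · have := hX r hr (hbody _ (holds_body ih hneg))
          rw [hp] at this
          exact this.1
        · exact hp.2
    refine ⟨fun p => ⟨fun hp => ?_, hder p⟩, ?_⟩
    · refine hmin (y := {q | Derives P X X q}) ?_ hder hp
      intro r hr hb
      have hpos : ∀ q, Literal.pos q ∈ r.body → Derives P X X q := fun q hq => (hb _ hq).2
      have hneg : ∀ q, Literal.neg q ∈ r.body → q ∉ X := fun q hq => (hb _ hq).1
      have hh := hX r hr (hbody _ fun l hl => (hb l hl).1)
      cases hd : r.head with
      | atom q =>
        have := Derives.intro (C := X) r hr q (.inl hd) hpos hneg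
        exact ⟨hder q this, this⟩
      | choice q =>
        by_cases hq : q ∈ X
        · exact .inl ⟨hq, Derives.intro (C := X) r hr q (.inr ⟨hd, hq⟩) hpos hneg⟩
        · exact .inr ⟨hq, fun h => hq (hder q h)⟩
      | bot => rw [hd] at hh; exact hh
    · rintro ⟨r, hr, hd, hb⟩
      have := hX r hr (hbody _ hb)
      rw [hd] at this
      exact this
  · rintro ⟨hX, hv⟩
    refine ⟨?_, ?_⟩
    · intro r hr hb
      cases hd : r.head with
      | atom q =>
        have : q ∈ X := (hX q).2 (.intro r hr q (.inl hd) (fun q hq => (hX q).1 (hb _ hq).1)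
          (fun q hq => (hb _ hq).1))
        exact ⟨this, this⟩
      | choice q =>
        by_cases hq : q ∈ X
        · exact .inl ⟨hq, hq⟩
        · exact .inr ⟨hq, hq⟩
      | bot => exact hv ⟨r, hr, hd, fun l hl => (hb l hl).1⟩
    · intro Y hY hYX p hp
      have := (hX p).1 hp
      clear hp
      induction this with
      | intro r hr p hp hpos hneg ih =>
        have hh := hY r hr <| by
          rintro (q | q) hq
          · exact ⟨(hX q).2 (hpos q hq), ih q hq⟩
          · exact ⟨hneg q hq, fun h => hneg q hq (hYX h)⟩
        rcases hp with hp | ⟨hp, hpX⟩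
        · rw [hp] at hh
          exact hh.2
        · rw [hp] at hh
          rcases hh with hh | hh
          · exact hh.2
          · exact absurd hpX hh.1

/-- Integrity constraints eliminate stable models and have no other effect. -/
theorem isStable_union_fixcons {α : Type u} {P : Program α} {X Y M : Set α} (hYX : Y ⊆ X) :
    (P ∪ fixcons Y X : Program α).IsStable M ↔ P.IsStable M ∧ M ∩ X = Y := by
  have hder : ∀ p, Derives (P ∪ fixcons Y X) M M p ↔ Derives P M M p := by
    intro p
    constructor
    · intro h
      induction h with
      | intro r hr p hp hpos hneg ih =>
        rcases hr with hr | ⟨x, hx, rfl⟩ | ⟨x, hx, rfl⟩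
        · exact .intro r hr p hp ih hneg
        · simp at hp
        · simp at hp
    · intro h
      induction h with
      | intro r hr p hp hpos hneg ih => exact .intro r (.inl hr) p hp ih hneg
  have hviol : (P ∪ fixcons Y X : Program α).Violated M ↔ P.Violated M ∨ M ∩ X ≠ Y := by
    constructor
    · rintro ⟨r, hr | ⟨x, hx, rfl⟩ | ⟨x, hx, rfl⟩, hd, hb⟩
      · exact .inl ⟨r, hr, hd, hb⟩
      · right
        rintro rfl
        exact hb _ rfl hx.1
      · right
        rintro rfl
        exact hx.2 ⟨hb _ rfl, hx.1⟩
    · rintro (⟨r, hr, hd, hb⟩ | h)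
      · exact ⟨r, .inl hr, hd, hb⟩
      · by_contra hn
        apply h
        ext x
        constructor
        · rintro ⟨hxM, hxX⟩
          by_contra hxY
          refine hn ⟨_, .inr (.inr ⟨x, ⟨hxX, hxY⟩, rfl⟩), rfl, ?_⟩
          rintro l rfl
          exact hxM
        · intro hxY
          refine ⟨?_, hYX hxY⟩
          by_contra hxM
          refine hn ⟨_, .inr (.inl ⟨x, hxY, rfl⟩), rfl, ?_⟩
          rintro l rfl
          exact hxM
  rw [isStable_iff, isStable_iff, hviol]
  simp only [Program.IsClosed, hder]
  tauto

/-! ### Programs in generate-define-test form -/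

/-- A stratified program over finitely many atoms has a level function: it does not decrease along
positive edges and increases along negative edges of the dependency graph. -/
theorem Program.Stratified.exists_level {α : Type u} [Finite α] {P : Program α}
    (hP : P.Stratified) :
    ∃ lev : α → ℕ, (∀ p q, P.PosEdge p q → lev p ≤ lev q) ∧
      ∀ p q, P.NegEdge p q → lev p < lev q := by
  let R : α → α → Prop := Relation.ReflTransGen (fun a b => P.PosEdge a b ∨ P.NegEdge a b)
  -- The level of `q` is the number of atoms that reach `q` without being reachable from it.
  let below : α → Set α := fun q => {p | R p q ∧ ¬ R q p}
  have hmono : ∀ p q, R p q → below p ⊆ below q := fun p q hpq r hr =>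
    ⟨hr.1.trans hpq, fun h => hr.2 (hpq.trans h)⟩
  refine ⟨fun q => (below q).ncard, fun p q h => ?_, fun p q h => ?_⟩
  · exact Set.ncard_le_ncard (hmono p q (.single (.inl h))) (Set.toFinite _)
  · have hpq : R p q := .single (.inr h)
    refine Set.ncard_lt_ncard ⟨hmono p q hpq, fun hsub => ?_⟩ (Set.toFinite _)
    have : p ∈ below p := hsub ⟨hpq, hP p q h⟩
    exact this.2 .refl

/-- In a stratified program, what is derivable on one level depends only on the evaluation of the
negative literals on lower levels. So two sets of derivable atoms coincide if the sets used to
evaluate the negative literals differ only at atoms where the sets of derivable atoms differ. -/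
theorem Program.Stratified.derives_unique {α : Type u} [Finite α] {P : Program α}
    (hP : P.Stratified) {C Z W : Set α}
    (h : ∀ p, (p ∈ Z ↔ p ∈ W) ∨ ¬ (Derives P C Z p ↔ Derives P C W p)) (p : α) :
    Derives P C Z p ↔ Derives P C W p := by
  obtain ⟨lev, hpos, hneg⟩ := hP.exists_level
  suffices H : ∀ k p, lev p < k → (Derives P C Z p ↔ Derives P C W p) from
    H _ p (Nat.lt_succ_self _)
  intro k
  induction k with
  | zero => intro p hp; omega
  | succ k ih =>
    have key : ∀ V V' : Set α, (∀ q, lev q < k → (q ∈ V ↔ q ∈ V')) →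
        ∀ p, Derives P C V p → lev p < k + 1 → Derives P C V' p := by
      intro V V' hVV p hp
      induction hp with
      | intro r hr p hp hpb hnb ihp =>
        intro hlev
        have hm : r.head.Mentions p := by
          rcases hp with hp | hp
          · rw [hp]; rfl
          · rw [hp.1]; rfl
        refine .intro r hr p hp (fun q hq => ihp q hq ?_) (fun q hq hqV => hnb q hq ?_)
        · have := hpos q p ⟨r, hr, hm, hq⟩
          omega
        · have := hneg q p ⟨r, hr, hm, hq⟩
          exact (hVV q (by omega)).2 hqV
    have hZW : ∀ q, lev q < k → (q ∈ Z ↔ q ∈ W) := fun q hq =>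
      (h q).resolve_right fun hn => hn (ih q hq)
    exact fun p hp => ⟨fun hd => key Z W hZW p hd hp,
      fun hd => key W Z (fun q hq => (hZW q hq).symm) p hd hp⟩

/-- A stratified program has exactly one closed set once the choices are made. Existence: the
operator `Z ↦ {p | Derives P C Z p}` is antitone, so that its square has a least fixed point, and
by stratification this is a fixed point of the operator itself. -/
theorem Program.Stratified.existsUnique {α : Type u} [Finite α] {P : Program α}
    (hP : P.Stratified) (C : Set α) : ∃! Z : Set α, ∀ p, p ∈ Z ↔ Derives P C Z p := by
  have hanti : ∀ {Z W : Set α}, Z ⊆ W → ∀ p, Derives P C W p → Derives P C Z p := by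
    intro Z W hZW p hp
    induction hp with
    | intro r hr p hp hpb hnb ih => exact .intro r hr p hp ih fun q hq hqZ => hnb q hq (hZW hqZ)
  let Γ : Set α → Set α := fun Z => {p | Derives P C Z p}
  let Γ2 : Set α →o Set α := ⟨fun Z => Γ (Γ Z), fun Z W hZW => hanti (hanti hZW)⟩
  have hfix : Γ (Γ (OrderHom.lfp Γ2)) = OrderHom.lfp Γ2 := Γ2.map_lfp
  have hpair : ∀ p, Derives P C (Γ (OrderHom.lfp Γ2)) p ↔ p ∈ OrderHom.lfp Γ2 := fun p => by
    conv_rhs => rw [← hfix]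
    rfl
  refine ⟨OrderHom.lfp Γ2, fun p => ?_, fun Z hZ => ?_⟩
  · rw [← hpair]
    refine hP.derives_unique (fun q => ?_) p
    rw [hpair]
    change (Derives P C (OrderHom.lfp Γ2) q ↔ _) ∨ ¬ (_ ↔ Derives P C (OrderHom.lfp Γ2) q)
    tauto
  · have hL : ∀ p, p ∈ OrderHom.lfp Γ2 ↔ Derives P C (OrderHom.lfp Γ2) p := fun p => by
      rw [← hpair]
      refine hP.derives_unique (fun q => ?_) p
      rw [hpair]
      change (Derives P C (OrderHom.lfp Γ2) q ↔ _) ∨ ¬ (_ ↔ Derives P C (OrderHom.lfp Γ2) q)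
      tauto
    ext p
    rw [hZ, hL]
    refine hP.derives_unique (fun q => ?_) p
    rw [← hZ, ← hL]
    tauto

/-- In a program in generate-define-test form, each choice among the atoms of the choice rules
extends to exactly one closed set. -/
theorem Program.IsGDT.existsUnique {α : Type u} [Finite α] {P : Program α} (hP : P.IsGDT)
    (Y : Set α) :
    ∃! Z : Set α, P.IsClosed Z ∧ ∀ p, (⟨.choice p, ∅⟩ : Rule α) ∈ P → (p ∈ Z ↔ p ∈ Y) := by
  have hch : ∀ r ∈ P, ∀ p, r.head = .choice p → r = ⟨.choice p, ∅⟩ := by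
    rintro ⟨hd, b⟩ hr p rfl
    obtain ⟨rfl, -⟩ := hP.2 _ hr p rfl
    rfl
  have hcongr : ∀ C C' Z : Set α, (∀ p, (⟨.choice p, ∅⟩ : Rule α) ∈ P → (p ∈ C ↔ p ∈ C')) →
      ∀ p, Derives P C Z p → Derives P C' Z p := by
    intro C C' Z hC p hp
    induction hp with
    | intro r hr p hp hpb hnb ih =>
      refine .intro r hr p (hp.imp_right fun h => ⟨h.1, (hC p ?_).1 h.2⟩) ih hnb
      rw [← hch r hr p h.1]
      exact hr
  have hiff : ∀ Z : Set α, (P.IsClosed Z ∧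
      ∀ p, (⟨.choice p, ∅⟩ : Rule α) ∈ P → (p ∈ Z ↔ p ∈ Y)) ↔ ∀ p, p ∈ Z ↔ Derives P Y Z p := by
    intro Z
    constructor
    · rintro ⟨hcl, hZY⟩ p
      rw [hcl p]
      exact ⟨hcongr Z Y Z hZY p, hcongr Y Z Z (fun q hq => (hZY q hq).symm) p⟩
    · intro hZ
      have hZY : ∀ p, (⟨.choice p, ∅⟩ : Rule α) ∈ P → (p ∈ Z ↔ p ∈ Y) := by
        intro p hp
        constructor
        · intro hpZ
          obtain ⟨r, hr, _, hd, -, -⟩ := (hZ p).1 hpZ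
          -- No rule besides `{p} ←` has `p` in its head.
          have hr' : r = ⟨.choice p, ∅⟩ := (hP.2 _ hp p rfl).2 r hr <| by
            rcases hd with hd | hd
            · rw [hd]; rfl
            · rw [hd.1]; rfl
          rcases hd with hd | hd
          · rw [hr'] at hd; cases hd
          · exact hd.2
        · intro hpY
          exact (hZ p).2 (.intro _ hp p (.inr ⟨rfl, hpY⟩) (by simp) (by simp))
      refine ⟨fun p => ?_, hZY⟩
      rw [hZ p]
      exact ⟨hcongr Y Z Z (fun q hq => (hZY q hq).symm) p, hcongr Z Y Z hZY p⟩
  simp only [hiff]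
  exact hP.1.existsUnique Y

end ASP

/-! ### Plans on single states -/

namespace Planning

open ASP

universe u v w

variable {F : Type u} {N : Type v} {S : Type w}

/-- The plan `p` is executable in the state `s` and leads to a state in `G`. -/
def Plan.Leads (sensed : S → F) (Φ : Transition F N S) (G : Set (Set F)) :
    Plan N S → Set F → Prop
  | .nil, s => s ∈ G
  | .act a p, s => ∃ s', Φ s (.inl a) = some s' ∧ p.Leads sensed Φ G s'
  | .sense a p q, s => ∃ s', Φ s (.inr a) = some s' ∧
      (sensed a ∈ s' → p.Leads sensed Φ G s') ∧ (sensed a ∉ s' → q.Leads sensed Φ G s')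

theorem stepSet_eq_some {Φ : Transition F N S} {X Y : Set (Set F)} {a : N ⊕ S} :
    stepSet Φ X a = some Y ↔
      (∀ s ∈ X, ∃ s', Φ s a = some s') ∧ Y = {s' | ∃ s ∈ X, Φ s a = some s'} := by
  unfold stepSet
  split_ifs with h
  · obtain ⟨s, hs, h⟩ := h
    simp only [false_iff, not_and]
    intro hX
    obtain ⟨s', hs'⟩ := hX s hs
    simp [h] at hs'
  · push Not at h
    simp only [Option.some.injEq, eq_comm (b := Y), iff_and_self]
    exact fun _ s hs => Option.ne_none_iff_exists'.1 (h s hs)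

theorem runPlan_iff (sensed : S → F) (Φ : Transition F N S) (G : Set (Set F)) (p : Plan N S)
    (X : Set (Set F)) :
    (∃ Z, runPlan sensed Φ p X = some Z ∧ Z ⊆ G) ↔ ∀ s ∈ X, p.Leads sensed Φ G s := by
  induction p generalizing X with
  | nil => simp [runPlan, Plan.Leads, Set.subset_def]
  | act a p ih =>
    have hrun : (∃ Z, runPlan sensed Φ (.act a p) X = some Z ∧ Z ⊆ G) ↔
        ∃ Y, stepSet Φ X (.inl a) = some Y ∧ ∃ Z, runPlan sensed Φ p Y = some Z ∧ Z ⊆ G := by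
      rw [runPlan]
      cases stepSet Φ X (.inl a) <;> simp
    simp only [hrun, ih, stepSet_eq_some, Plan.Leads]
    constructor
    · rintro ⟨Y, ⟨hX, rfl⟩, hY⟩ s hs
      obtain ⟨s', hs'⟩ := hX s hs
      exact ⟨s', hs', hY s' ⟨s, hs, hs'⟩⟩
    · intro h
      refine ⟨_, ⟨fun s hs => (h s hs).imp fun _ h => h.1, rfl⟩, ?_⟩
      rintro s' ⟨s, hs, hs'⟩
      obtain ⟨t, ht, hG⟩ := h s hs
      rw [hs'] at ht
      cases ht
      exact hG
  | sense a p q ihp ihq =>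
    have hrun : (∃ Z, runPlan sensed Φ (.sense a p q) X = some Z ∧ Z ⊆ G) ↔
        ∃ Y, stepSet Φ X (.inr a) = some Y ∧
          (∃ Z, runPlan sensed Φ p {s ∈ Y | sensed a ∈ s} = some Z ∧ Z ⊆ G) ∧
          ∃ Z, runPlan sensed Φ q {s ∈ Y | sensed a ∉ s} = some Z ∧ Z ⊆ G := by
      rw [runPlan]
      cases stepSet Φ X (.inr a) with
      | none => simp
      | some Y =>
        simp only [Option.some.injEq, exists_eq_left']
        cases runPlan sensed Φ p {s ∈ Y | sensed a ∈ s} <;>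
          cases runPlan sensed Φ q {s ∈ Y | sensed a ∉ s} <;> simp
    simp only [hrun, ihp, ihq, stepSet_eq_some, Plan.Leads]
    constructor
    · rintro ⟨Y, ⟨hX, rfl⟩, hp, hq⟩ s hs
      obtain ⟨s', hs'⟩ := hX s hs
      exact ⟨s', hs', fun h => hp s' ⟨⟨s, hs, hs'⟩, h⟩, fun h => hq s' ⟨⟨s, hs, hs'⟩, h⟩⟩
    · intro h
      refine ⟨_, ⟨fun s hs => (h s hs).imp fun _ h => h.1, rfl⟩, ?_, ?_⟩
      · rintro s' ⟨⟨s, hs, hs'⟩, hf⟩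
        obtain ⟨t, ht, hG, -⟩ := h s hs
        rw [hs'] at ht
        cases ht
        exact hG hf
      · rintro s' ⟨⟨s, hs, hs'⟩, hf⟩
        obtain ⟨t, ht, -, hG⟩ := h s hs
        rw [hs'] at ht
        cases ht
        exact hG hf

/-! ### Transitions as stable models of the dynamic rules -/

/-- The set of atoms `s' ∪ O ∪ t`, for states `s`, `t` and a set `O` of actions. -/
def stepModel (s : Set F) (O : Set (N ⊕ S)) (t : Set F) : Set (DynAtom F N S) :=
  {p | match p with
    | .fluent f => f ∈ t
    | .prev f => f ∈ s
    | .action a => a ∈ O}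

/-- The program `s' ∪ {a ← | a ∈ O} ∪ DR`. -/
def multiStepProgram (D : Description F N S) (s : Set F) (O : Set (N ⊕ S)) :
    Program (DynAtom F N S) :=
  facts (prevState s) ∪ facts (DynAtom.action '' O) ∪ D.dyn

variable {D : Description F N S} {s t : Set F} {O : Set (N ⊕ S)} {W : Set (DynAtom F N S)}

theorem derives_prev {f : F}
    (hf : f ∈ s) : Derives (multiStepProgram D s O) W W (.prev f) :=
  .intro (fact (.prev f)) (.inl (.inl ⟨_, ⟨f, hf, rfl⟩, rfl⟩)) _ (.inl rfl)
    (by simp [fact]) (by simp [fact])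

theorem derives_occurs {a : N ⊕ S}
    (ha : a ∈ O) : Derives (multiStepProgram D s O) W W (.action a) :=
  .intro (fact (.action a)) (.inl (.inr ⟨_, ⟨a, ha, rfl⟩, rfl⟩)) _ (.inl rfl)
    (by simp [fact]) (by simp [fact])

theorem mem_of_derives_prev {f : F}
    (h : Derives (multiStepProgram D s O) W W (.prev f)) : f ∈ s := by
  obtain ⟨r, (⟨_, ⟨g, hg, rfl⟩, rfl⟩ | ⟨_, ⟨a, ha, rfl⟩, rfl⟩) | hr, _, hd, -, -⟩ := h
  · simp only [fact, Head.atom.injEq, DynAtom.prev.injEq, reduceCtorEq, false_and, or_false] at hd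
    exact hd ▸ hg
  · simp [fact] at hd
  · obtain ⟨g, hg⟩ := D.dyn_head r hr (.prev f) <| by
      rcases hd with hd | hd
      · rw [hd]; rfl
      · rw [hd.1]; rfl
    cases hg

theorem mem_of_derives_occurs {a : N ⊕ S}
    (h : Derives (multiStepProgram D s O) W W (.action a)) : a ∈ O := by
  obtain ⟨r, (⟨_, ⟨g, hg, rfl⟩, rfl⟩ | ⟨_, ⟨b, hb, rfl⟩, rfl⟩) | hr, _, hd, -, -⟩ := h
  · simp [fact] at hd
  · simp only [fact, Head.atom.injEq, DynAtom.action.injEq, reduceCtorEq, false_and,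
      or_false] at hd
    exact hd ▸ hb
  · obtain ⟨g, hg⟩ := D.dyn_head r hr (.action a) <| by
      rcases hd with hd | hd
      · rw [hd]; rfl
      · rw [hd.1]; rfl
    cases hg

theorem violated_multiStepProgram_iff :
    (multiStepProgram D s O).Violated W ↔ D.dyn.Violated W := by
  constructor
  · rintro ⟨r, (⟨_, -, rfl⟩ | ⟨_, -, rfl⟩) | hr, hd, hb⟩
    · simp [fact] at hd
    · simp [fact] at hd
    · exact ⟨r, hr, hd, hb⟩
  · rintro ⟨r, hr, hd, hb⟩
    exact ⟨r, .inr hr, hd, hb⟩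

/-- Each stable model of `s' ∪ {a ← | a ∈ O} ∪ DR` is of the form `s' ∪ O ∪ t`, since all head
atoms of dynamic rules are fluents. -/
theorem eq_stepModel {M : Set (DynAtom F N S)} (hM : (multiStepProgram D s O).IsStable M) :
    M = stepModel s O {f | DynAtom.fluent f ∈ M} := by
  have hcl := (isStable_iff.1 hM).1
  ext p
  cases p with
  | fluent f => rfl
  | prev f => exact (hcl _).trans ⟨mem_of_derives_prev, fun h => derives_prev h⟩
  | action a => exact (hcl _).trans ⟨mem_of_derives_occurs, fun h => derives_occurs h⟩

/-- The dynamic rules allow the transition from `s` to `t` under the actions in `O`: the set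
`s' ∪ O ∪ t` is a stable model of `s' ∪ {a ← | a ∈ O} ∪ DR`. -/
def Step (D : Description F N S) (s : Set F) (O : Set (N ⊕ S)) (t : Set F) : Prop :=
  (multiStepProgram D s O).IsStable (stepModel s O t)

theorem step_empty_iff (hD : Inertial D.dyn) : Step D s ∅ t ↔ t = s := by
  have h := hD s
  have hs : ∀ t : Set F, (stepModel s ∅ t : Set (DynAtom F N S)) =
      prevState s ∪ DynAtom.fluent '' t := by
    intro t
    ext p
    cases p <;> simp [stepModel, prevState]
  have hinj : ∀ t : Set F, (prevState s ∪ DynAtom.fluent '' t : Set (DynAtom F N S)) =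
      prevState s ∪ DynAtom.fluent '' s → t = s := by
    intro t ht
    ext f
    simpa [prevState] using Set.ext_iff.1 ht (.fluent f)
  have hst : Step D s ∅ t ↔
      stepModel s ∅ t ∈ (facts (prevState s) ∪ D.dyn : Program (DynAtom F N S)).SM := by
    simp [Step, multiStepProgram, Program.SM, facts]
  rw [hst, h, hs, Set.mem_singleton_iff]
  exact ⟨hinj t, fun h => by rw [h]⟩

theorem step_singleton_iff (hD : Deterministic D.dyn) (a : N ⊕ S) :
    Step D s {a} t ↔ dynTrans D.dyn s a = some t := by
  have hst : ∀ M, (stepProgram D.dyn s a).IsStable M ↔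
      (multiStepProgram D s {a}).IsStable M := by
    simp [stepProgram, multiStepProgram, facts]
  unfold dynTrans
  split_ifs with h
  · have hc := h.choose_spec.1
    have hM := eq_stepModel ((hst _).1 hc)
    rw [Option.some.injEq]
    constructor
    · intro ht
      have := hD s a hc ((hst _).2 ht)
      change h.choose = _ at this
      rw [this]
      rfl
    · rintro rfl
      unfold Step
      rw [← hst]
      rwa [hM] at hc
  · simp only [iff_false]
    exact fun ht => h ⟨_, (hst _).2 ht, fun M hM => hD s a hM ((hst _).2 ht)⟩

end Planning

/-! ### The game of choosing actions and observations -/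

namespace Planning

open ASP

universe u v w

/-- The sequence `x, e 0, e 1, …`. -/
def scons {α : Type u} (x : α) (e : ℕ → α) : ℕ → α
  | 0 => x
  | T + 1 => e T

/-- The game `∃O₀ ∀b₀ … ∃Oₘ₋₁ ∀bₘ₋₁ ∃Oₘ C`, where `C` is a condition on the sequence
`(O₀, b₀), (O₁, b₁), …` of choices. The last entry is `(Oₘ, False)`,
repeated forever, since nothing is observed after the last step. -/
def Game {α : Type u} : ℕ → ((ℕ → Set α × Prop) → Prop) → Prop
  | 0, C => ∃ O, C fun _ => (O, False)
  | m + 1, C => ∃ O, ∀ b, Game m fun e => C (scons (O, b) e)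

theorem Game.mono {α : Type u} {m : ℕ} {C C' : (ℕ → Set α × Prop) → Prop} (h : Game m C)
    (hC : ∀ e, ¬ (e m).2 → C e → C' e) : Game m C' := by
  induction m generalizing C C' with
  | zero => exact h.imp fun O hO => hC _ id hO
  | succ m ih => exact h.imp fun O hO b => ih (hO b) fun e he => hC _ he

theorem Game.congr {α : Type u} {m : ℕ} {C C' : (ℕ → Set α × Prop) → Prop}
    (hC : ∀ e, ¬ (e m).2 → (C e ↔ C' e)) : Game m C ↔ Game m C' :=
  ⟨fun h => h.mono fun e he => (hC e he).1, fun h => h.mono fun e he => (hC e he).2⟩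

theorem Game.exists {α : Type u} {m : ℕ} {C : (ℕ → Set α × Prop) → Prop} (h : Game m C) :
    ∃ e, C e := by
  induction m generalizing C with
  | zero => exact h.imp' _ fun O hO => hO
  | succ m ih =>
    obtain ⟨O, hO⟩ := h
    obtain ⟨e, he⟩ := ih (hO False)
    exact ⟨_, he⟩

variable {F : Type u} {N : Type v} {S : Type w}

/-- After a sensing action, the announced observation `x.2` is not what is observed in `s`. -/
def Mismatch (sensed : S → F) (x : Set (N ⊕ S) × Prop) (s : Set F) : Prop :=
  ∃ a, Sum.inr a ∈ x.1 ∧ ¬ (sensed a ∈ s ↔ x.2)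

/-- The observation is announced as true although the action is not a sensing action. -/
def Idle (x : Set (N ⊕ S) × Prop) : Prop := x.2 ∧ ∃ a, Sum.inl a ∈ x.1

/-- The actions `(e 1).1, …, (e m).1` are executable from `s` and lead to `G`, unless at some
point an announced observation is wrong or idle; `e 0` is the preceding choice. -/
def Run (sensed : S → F) (D : Description F N S) (G : Set (Set F)) :
    ℕ → (ℕ → Set (N ⊕ S) × Prop) → Set F → Prop
  | 0, _, s => s ∈ G
  | m + 1, e, s => Mismatch sensed (e 0) s ∨ Idle (e 1) ∨
      ∃ t, Step D s (e 1).1 t ∧ Run sensed D G m (fun T => e (T + 1)) t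

/-- The winning condition: at most one action is chosen at each time, and for all states in `X`
the goal is reached unless an announced observation is wrong or idle. -/
def Wins (sensed : S → F) (D : Description F N S) (G X : Set (Set F)) (m : ℕ)
    (x : Set (N ⊕ S) × Prop) (e : ℕ → Set (N ⊕ S) × Prop) : Prop :=
  (∀ T ≤ m, (e T).1.Subsingleton) ∧ ∀ s ∈ X, Run sensed D G (m + 1) (scons x e) s

variable {sensed : S → F} {D : Description F N S} {G : Set (Set F)}

theorem wins_succ_iff {X : Set (Set F)} {m : ℕ} {x y : Set (N ⊕ S) × Prop}
    {e : ℕ → Set (N ⊕ S) × Prop} :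
    Wins sensed D G X (m + 1) x (scons y e) ↔
      y.1.Subsingleton ∧ (∀ T ≤ m, (e T).1.Subsingleton) ∧
        ∀ s ∈ X, Mismatch sensed x s ∨ Idle y ∨
          ∃ t, Step D s y.1 t ∧ Run sensed D G (m + 1) (scons y e) t := by
  unfold Wins
  rw [← and_assoc]
  refine and_congr ⟨fun h => ⟨h 0 (Nat.zero_le _), fun T hT => h (T + 1) (by omega)⟩,
    fun h T hT => ?_⟩ Iff.rfl
  cases T with
  | zero => exact h.1
  | succ T => exact h.2 T (by omega)

/-- The states that are reached by `O` from the states in `X` without a mismatch. -/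
def nextStates (sensed : S → F) (D : Description F N S) (X : Set (Set F))
    (x : Set (N ⊕ S) × Prop) (O : Set (N ⊕ S)) : Set (Set F) :=
  {t | ∃ s ∈ X, ¬ Mismatch sensed x s ∧ Step D s O t}

/-- Nothing is required of the further actions after an idle observation. -/
theorem game_wins_of_idle (X : Set (Set F)) (m : ℕ) (x y : Set (N ⊕ S) × Prop)
    (hy : y.1.Subsingleton) (h : Idle y) :
    Game m fun e => Wins sensed D G X (m + 1) x (scons y e) := by
  have H : ∀ m, Game m fun e : ℕ → Set (N ⊕ S) × Prop => ∀ T ≤ m, (e T).1.Subsingleton := by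
    intro m
    induction m with
    | zero => exact ⟨∅, fun _ _ => Set.subsingleton_empty⟩
    | succ m ih =>
      refine ⟨∅, fun b => ih.mono fun e _ he T hT => ?_⟩
      cases T with
      | zero => exact Set.subsingleton_empty
      | succ T => exact he T (by omega)
  exact (H m).mono fun e _ he => wins_succ_iff.2 ⟨hy, he, fun s _ => .inr (.inl h)⟩

theorem game_wins_of_next {X : Set (Set F)} {m : ℕ} {x y : Set (N ⊕ S) × Prop}
    (hy : y.1.Subsingleton)
    (hex : ∀ s ∈ X, ¬ Mismatch sensed x s → ∃ t, Step D s y.1 t)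
    (h : Game m (Wins sensed D G (nextStates sensed D X x y.1) m y)) :
    Game m fun e => Wins sensed D G X (m + 1) x (scons y e) := by
  refine h.mono fun e _ he => wins_succ_iff.2 ⟨hy, he.1, fun s hs => ?_⟩
  by_cases hx : Mismatch sensed x s
  · exact .inl hx
  · obtain ⟨t, ht⟩ := hex s hs hx
    exact .inr (.inr ⟨t, ht, he.2 t ⟨s, hs, hx, ht⟩⟩)

theorem game_next_of_wins {X : Set (Set F)} {m : ℕ} {x y : Set (N ⊕ S) × Prop}
    (huniq : ∀ s t t', Step D s y.1 t → Step D s y.1 t' → t = t') (hi : ¬ Idle y)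
    (h : Game m fun e => Wins sensed D G X (m + 1) x (scons y e)) :
    (∀ s ∈ X, ¬ Mismatch sensed x s → ∃ t, Step D s y.1 t) ∧
      Game m (Wins sensed D G (nextStates sensed D X x y.1) m y) := by
  constructor
  · intro s hs hx
    obtain ⟨e, he⟩ := h.exists
    obtain ⟨t, ht, -⟩ := (((wins_succ_iff.1 he).2.2 s hs).resolve_left hx).resolve_left hi
    exact ⟨t, ht⟩
  · refine h.mono fun e _ he => ?_
    have he := wins_succ_iff.1 he
    refine ⟨he.2.1, ?_⟩
    rintro t ⟨s, hs, hx, ht⟩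
    obtain ⟨t', ht', hrun⟩ := ((he.2.2 s hs).resolve_left hx).resolve_left hi
    rwa [huniq s t t' ht ht']

theorem step_unique (hdet : Deterministic D.dyn) (hin : Inertial D.dyn) {O : Set (N ⊕ S)}
    (hO : O.Subsingleton) (s t t' : Set F) (h : Step D s O t) (h' : Step D s O t') :
    t = t' := by
  rcases hO.eq_empty_or_singleton with rfl | ⟨a, rfl⟩
  · rw [step_empty_iff hin] at h h'
    rw [h, h']
  · rw [step_singleton_iff hdet] at h h'
    exact Option.some.inj (h.symm.trans h')

/-- The strategies that win the game correspond to plans: an empty choice of actions skips a time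
step, and the two answers after a sensing action are the branches of a conditional plan. -/
theorem game_wins_iff (hdet : Deterministic D.dyn) (hin : Inertial D.dyn) (m : ℕ)
    (x : Set (N ⊕ S) × Prop) (X : Set (Set F)) :
    Game m (Wins sensed D G X m x) ↔
      ∃ p : Plan N S, p.length ≤ m + 1 ∧
        ∀ s ∈ X, ¬ Mismatch sensed x s → p.Leads sensed (dynTrans D.dyn) G s := by
  have hempty : ∀ (b : Prop) (s : Set F), ¬ Mismatch sensed ((∅ : Set (N ⊕ S)), b) s := by
    rintro b s ⟨a, ha, -⟩
    exact ha
  induction m generalizing x X with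
  | zero =>
    have hrun : ∀ (O : Set (N ⊕ S)) s, Run sensed D G 1 (scons x fun _ => (O, False)) s ↔
        Mismatch sensed x s ∨ ∃ t, Step D s O t ∧ t ∈ G := by
      intro O s
      simp [Run, scons, Idle]
    simp only [Game, Wins, hrun]
    constructor
    · rintro ⟨O, hO, h⟩
      have h' : ∀ s ∈ X, ¬ Mismatch sensed x s → ∃ t, Step D s O t ∧ t ∈ G :=
        fun s hs hx => (h s hs).resolve_left hx
      rcases (hO 0 le_rfl).eq_empty_or_singleton with rfl | ⟨a | a, rfl⟩
      · simp only [step_empty_iff hin, exists_eq_left] at h'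
        exact ⟨.nil, by simp [Plan.length], h'⟩
      · simp only [step_singleton_iff hdet] at h'
        exact ⟨.act a .nil, by simp [Plan.length], h'⟩
      · simp only [step_singleton_iff hdet] at h'
        refine ⟨.sense a .nil .nil, by simp [Plan.length], fun s hs hx => ?_⟩
        obtain ⟨t, ht, hG⟩ := h' s hs hx
        exact ⟨t, ht, fun _ => hG, fun _ => hG⟩
    · rintro ⟨p, hp, h⟩
      suffices H : ∃ O : Set (N ⊕ S), O.Subsingleton ∧
          ∀ s ∈ X, ¬ Mismatch sensed x s → ∃ t, Step D s O t ∧ t ∈ G by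
        obtain ⟨O, hO, H⟩ := H
        exact ⟨O, fun _ _ => hO, fun s hs => or_iff_not_imp_left.2 (H s hs)⟩
      have hnil : ∀ p : Plan N S, p.length = 0 → p = .nil := by
        intro p hp
        cases p <;> simp [Plan.length] at hp ⊢
      cases p with
      | nil =>
        refine ⟨∅, Set.subsingleton_empty, ?_⟩
        simp only [step_empty_iff hin, exists_eq_left]
        exact h
      | act a p =>
        refine ⟨{.inl a}, Set.subsingleton_singleton, ?_⟩
        simp only [Plan.length] at hp
        obtain rfl := hnil p (by omega)
        simp only [step_singleton_iff hdet]
        exact h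
      | sense a p q =>
        refine ⟨{.inr a}, Set.subsingleton_singleton, ?_⟩
        simp only [Plan.length] at hp
        obtain rfl := hnil p (by omega)
        obtain rfl := hnil q (by omega)
        simp only [step_singleton_iff hdet]
        intro s hs hx
        obtain ⟨t, ht, h1, h2⟩ := h s hs hx
        exact ⟨t, ht, (em (sensed a ∈ t)).elim h1 h2⟩
  | succ m ih =>
    constructor
    · rintro ⟨O, h⟩
      have hO : O.Subsingleton := by
        obtain ⟨e, he⟩ := (h False).exists
        exact (wins_succ_iff.1 he).1
      -- An answer that is not idle has to be answered by a plan for the reached states.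
      have key : ∀ b, ¬ Idle (O, b) → (∀ s ∈ X, ¬ Mismatch sensed x s → ∃ t, Step D s O t) ∧
          ∃ p : Plan N S, p.length ≤ m + 1 ∧ ∀ t ∈ nextStates sensed D X x O,
            ¬ Mismatch sensed (O, b) t → p.Leads sensed (dynTrans D.dyn) G t := by
        intro b hb
        obtain ⟨h1, h2⟩ := game_next_of_wins (step_unique hdet hin hO) hb (h b)
        exact ⟨h1, (ih _ _).1 h2⟩
      obtain ⟨hex, p, hp, hlead⟩ := key False (fun h => h.1)
      rcases hO.eq_empty_or_singleton with rfl | ⟨a | a, rfl⟩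
      · exact ⟨p, by omega, fun s hs hx =>
          hlead s ⟨s, hs, hx, (step_empty_iff hin).2 rfl⟩ (hempty _ _)⟩
      · refine ⟨.act a p, by simp only [Plan.length]; omega, fun s hs hx => ?_⟩
        obtain ⟨t, ht⟩ := hex s hs hx
        refine ⟨t, (step_singleton_iff hdet _).1 ht, hlead t ⟨s, hs, hx, ht⟩ ?_⟩
        rintro ⟨b, hb, -⟩
        cases hb
      · obtain ⟨-, p', hp', hlead'⟩ := key True <| by
          rintro ⟨-, b, hb⟩
          cases hb
        refine ⟨.sense a p' p, by simp only [Plan.length]; omega, fun s hs hx => ?_⟩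
        obtain ⟨t, ht⟩ := hex s hs hx
        refine ⟨t, (step_singleton_iff hdet _).1 ht,
          fun hf => hlead' t ⟨s, hs, hx, ht⟩ ?_, fun hf => hlead t ⟨s, hs, hx, ht⟩ ?_⟩
        · rintro ⟨b, hb, hn⟩
          cases hb
          exact hn (iff_of_true hf trivial)
        · rintro ⟨b, hb, hn⟩
          cases hb
          exact hn (iff_of_false hf id)
    · rintro ⟨p, hp, h⟩
      cases p with
      | nil =>
        refine ⟨∅, fun b => game_wins_of_next Set.subsingleton_empty
          (fun s _ _ => ⟨s, (step_empty_iff hin).2 rfl⟩)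
          ((ih _ _).2 ⟨.nil, Nat.zero_le _, ?_⟩)⟩
        rintro t ⟨s, hs, hx, ht⟩ -
        obtain rfl := (step_empty_iff hin).1 ht
        exact h t hs hx
      | act a p =>
        refine ⟨{.inl a}, fun b => ?_⟩
        by_cases hb : b
        · exact game_wins_of_idle _ _ _ _ Set.subsingleton_singleton ⟨hb, a, rfl⟩
        simp only [Plan.length] at hp
        simp only [Plan.Leads, ← step_singleton_iff hdet] at h
        refine game_wins_of_next Set.subsingleton_singleton
          (fun s hs hx => (h s hs hx).imp fun _ h => h.1) ((ih _ _).2 ⟨p, by omega, ?_⟩)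
        rintro t ⟨s, hs, hx, ht⟩ -
        obtain ⟨t', ht', hl⟩ := h s hs hx
        rwa [step_unique hdet hin Set.subsingleton_singleton s t t' ht ht']
      | sense a p q =>
        classical
        refine ⟨{.inr a}, fun b => ?_⟩
        simp only [Plan.length] at hp
        simp only [Plan.Leads, ← step_singleton_iff hdet] at h
        have hlead : ∀ t ∈ nextStates sensed D X x {.inr a},
            (sensed a ∈ t → p.Leads sensed (dynTrans D.dyn) G t) ∧
              (sensed a ∉ t → q.Leads sensed (dynTrans D.dyn) G t) := by
          rintro t ⟨s, hs, hx, ht⟩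
          obtain ⟨t', ht', hl⟩ := h s hs hx
          rwa [step_unique hdet hin Set.subsingleton_singleton s t t' ht ht']
        refine game_wins_of_next Set.subsingleton_singleton
          (fun s hs hx => (h s hs hx).imp fun _ h => h.1)
          ((ih _ _).2 ⟨if b then p else q, by split_ifs <;> omega, fun t ht hx => ?_⟩)
        have hiff : sensed a ∈ t ↔ b := by
          by_contra hn
          exact hx ⟨a, rfl, hn⟩
        split_ifs with hb
        · exact (hlead t ht).1 (hiff.2 hb)
        · exact (hlead t ht).2 fun hf => hb (hiff.1 hf)

end Planning

/-! ### Rules of the encoding -/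

namespace ASP

universe u v

/-- Some rule of `P` for the atom `p` is applicable, where positive literals are evaluated in `V`,
negative literals in `Z`, and choices in `C`. -/
def Fires {α : Type u} (P : Program α) (V C Z : Set α) (p : α) : Prop :=
  ∃ r ∈ P, (r.head = .atom p ∨ r.head = .choice p ∧ p ∈ C) ∧
    (∀ q, Literal.pos q ∈ r.body → q ∈ V) ∧ ∀ q, Literal.neg q ∈ r.body → q ∉ Z

theorem derives_iff {α : Type u} {P : Program α} {C Z : Set α} {p : α} :
    Derives P C Z p ↔ Fires P {q | Derives P C Z q} C Z p :=
  ⟨fun ⟨r, hr, _, hd, hp, hn⟩ => ⟨r, hr, hd, hp, hn⟩,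
    fun ⟨r, hr, hd, hp, hn⟩ => .intro r hr _ hd hp hn⟩

theorem Derives.induct {α : Type u} {P : Program α} {C Z V : Set α}
    (h : ∀ p, Fires P {q | Derives P C Z q ∧ q ∈ V} C Z p → p ∈ V) {p : α}
    (hp : Derives P C Z p) : p ∈ V := by
  induction hp with
  | intro r hr p hd hp hn ih => exact h p ⟨r, hr, hd, fun q hq => ⟨hp q hq, ih q hq⟩, hn⟩

theorem pos_mem_map {α : Type u} {β : Type v} {g : α → β} {B : Set (Literal α)} {q : β} :
    Literal.pos q ∈ Literal.map g '' B ↔ ∃ p, Literal.pos p ∈ B ∧ g p = q := by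
  constructor
  · rintro ⟨p | p, hp, h⟩
    · exact ⟨p, hp, by simpa [Literal.map] using h⟩
    · simp [Literal.map] at h
  · rintro ⟨p, hp, rfl⟩
    exact ⟨_, hp, rfl⟩

theorem neg_mem_map {α : Type u} {β : Type v} {g : α → β} {B : Set (Literal α)} {q : β} :
    Literal.neg q ∈ Literal.map g '' B ↔ ∃ p, Literal.neg p ∈ B ∧ g p = q := by
  constructor
  · rintro ⟨p | p, hp, h⟩
    · simp [Literal.map] at h
    · exact ⟨p, hp, by simpa [Literal.map] using h⟩
  · rintro ⟨p, hp, rfl⟩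
    exact ⟨_, hp, rfl⟩

theorem Literal.holds_map {α : Type u} {β : Type v} {g : α → β} {M : Set β} {l : Literal α} :
    (l.map g).Holds M ↔ l.Holds (g ⁻¹' M) := by
  cases l <;> rfl

theorem Head.map_eq_atom {α : Type u} {β : Type v} {g : α → β} {h : Head α} {q : β} :
    h.map g = .atom q ↔ ∃ p, h = .atom p ∧ g p = q := by
  cases h <;> simp [Head.map]

theorem Head.map_eq_choice {α : Type u} {β : Type v} {g : α → β} {h : Head α} {q : β} :
    h.map g = .choice q ↔ ∃ p, h = .choice p ∧ g p = q := by
  cases h <;> simp [Head.map]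

theorem Head.map_eq_bot {α : Type u} {β : Type v} {g : α → β} {h : Head α} :
    h.map g = .bot ↔ h = .bot := by
  cases h <;> simp [Head.map]

theorem Head.replaceBot_eq_atom {α : Type u} {h : Head α} {p q : α} :
    h.replaceBot p = .atom q ↔ h = .atom q ∨ h = .bot ∧ p = q := by
  cases h <;> simp [Head.replaceBot]

theorem Head.replaceBot_eq_choice {α : Type u} {h : Head α} {p q : α} :
    h.replaceBot p = .choice q ↔ h = .choice q := by
  cases h <;> simp [Head.replaceBot]

theorem Head.replaceBot_ne_bot {α : Type u} {h : Head α} {p : α} : h.replaceBot p ≠ .bot := by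
  cases h <;> simp [Head.replaceBot]

end ASP

namespace Planning

open ASP

universe u v w

variable {F : Type u} {N : Type v} {S : Type w}
variable {sensed : S → F} {D : Description F N S} {n : ℕ} {M : Set (EncAtom F N S)}

/-- The condition under which some rule of the encoding for a given atom is applicable, spelled out
for each kind of atoms. Positive literals are evaluated in `V`, and negative ones in `M`. -/
def Support (sensed : S → F) (D : Description F N S) (n : ℕ) (V M : Set (EncAtom F N S)) :
    EncAtom F N S → Prop
  | .t T => 1 ≤ T ∧ T ≤ n
  | .action _ => True
  | .senses a f => ∃ x, a = .inr x ∧ f = sensed x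
  | .occ a T => (1 ≤ T ∧ T ≤ n) ∧ .occ a T ∈ M
  | .obs T => (1 ≤ T ∧ T < n) ∧ .obs T ∈ M
  | .h f T =>
    (T = 0 ∧ ∃ r ∈ D.init, (r.head = .atom f ∨ r.head = .choice f ∧ .h f 0 ∈ M) ∧
      (∀ q, .pos q ∈ r.body → .h q 0 ∈ V) ∧ ∀ q, .neg q ∈ r.body → .h q 0 ∉ M) ∨
    ((1 ≤ T ∧ T ≤ n) ∧ .flag T ∉ M ∧ ∃ r ∈ D.dyn,
      (r.head = .atom (.fluent f) ∨ r.head = .choice (.fluent f) ∧ .h f T ∈ M) ∧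
      (∀ q, .pos q ∈ r.body → dynAtomAt T q ∈ V) ∧ ∀ q, .neg q ∈ r.body → dynAtomAt T q ∉ M)
  | .flag T =>
    (T = 0 ∧ ∃ r ∈ D.init, r.head = .bot ∧
      (∀ q, .pos q ∈ r.body → .h q 0 ∈ V) ∧ ∀ q, .neg q ∈ r.body → .h q 0 ∉ M) ∨
    ((1 ≤ T ∧ T ≤ n) ∧ (.flag (T - 1) ∈ V ∨
      (∃ a f, .occ a (T - 1) ∈ V ∧ .senses a f ∈ V ∧
        (.h f (T - 1) ∈ V ∧ .obs (T - 1) ∉ M ∨ .h f (T - 1) ∉ M ∧ .obs (T - 1) ∈ V)) ∨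
      ∃ a, .occ a T ∈ V ∧ .obs T ∈ V ∧ ∀ f, .senses a f ∉ M))

theorem fires_condProgram_iff {V : Set (EncAtom F N S)}
    (ht : ∀ T, 1 ≤ T → T ≤ n → .t T ∈ V) (ha : ∀ a, .action a ∈ V) {p : EncAtom F N S} :
    Fires (condProgram sensed D n) V M M p ↔ Support sensed D n V M p := by
  constructor
  · rintro ⟨r, hr, hd, hp, hn⟩
    rcases hr with ((((((⟨_, (⟨T, h1, h2, rfl⟩ | ⟨a, rfl⟩) | ⟨a, rfl⟩, rfl⟩) |
      ((⟨_, ⟨r, hr, rfl⟩, rfl⟩ | ⟨T, h1, h2, r, hr, rfl⟩) | ⟨g, hg, rfl⟩)) |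
      (⟨T, h1, h2, a, rfl⟩ | ⟨T, h1, h2, a, b, hab, rfl⟩)) | ⟨T, h1, h2, rfl⟩) |
      ⟨T, h1, h2, rfl⟩) | (⟨T, h1, h2, a, f, rfl⟩ | ⟨T, h1, h2, a, f, rfl⟩)) |
      ⟨T, h1, h2, a, rfl⟩
    · obtain rfl : EncAtom.t T = p := by simpa [fact] using hd
      exact ⟨h1, h2⟩
    · obtain rfl : EncAtom.action a = p := by simpa [fact] using hd
      trivial
    · obtain rfl : EncAtom.senses (.inr a) (sensed a) = p := by simpa [fact] using hd
      exact ⟨a, rfl, rfl⟩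
    · have hp' : ∀ q, .pos q ∈ r.body → .h q 0 ∈ V :=
        fun q hq => hp _ (pos_mem_map.2 ⟨q, hq, rfl⟩)
      have hn' : ∀ q, .neg q ∈ r.body → .h q 0 ∉ M :=
        fun q hq => hn _ (neg_mem_map.2 ⟨q, hq, rfl⟩)
      simp only [Rule.replaceBot, Rule.map, Head.replaceBot_eq_atom, Head.replaceBot_eq_choice,
        Head.map_eq_atom, Head.map_eq_choice, Head.map_eq_bot] at hd
      rcases hd with (⟨f, hd, rfl⟩ | ⟨hd, rfl⟩) | ⟨⟨f, hd, rfl⟩, hm⟩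
      · exact .inl ⟨rfl, r, hr, .inl hd, hp', hn'⟩
      · exact .inl ⟨rfl, r, hr, hd, hp', hn'⟩
      · exact .inl ⟨rfl, r, hr, .inr ⟨hd, hm⟩, hp', hn'⟩
    · have hp' : ∀ q, .pos q ∈ r.body → dynAtomAt T q ∈ V :=
        fun q hq => hp _ (.inr (.inr (pos_mem_map.2 ⟨q, hq, rfl⟩)))
      have hn' : ∀ q, .neg q ∈ r.body → dynAtomAt T q ∉ M :=
        fun q hq => hn _ (.inr (.inr (neg_mem_map.2 ⟨q, hq, rfl⟩)))
      have hfl : .flag T ∉ M := hn _ (.inl rfl)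
      simp only [Rule.addLit, Rule.map, Head.map_eq_atom, Head.map_eq_choice] at hd
      rcases hd with ⟨q, hd, rfl⟩ | ⟨⟨q, hd, rfl⟩, hm⟩
      · obtain ⟨f, rfl⟩ := D.dyn_head r hr q (by rw [hd]; rfl)
        exact .inr ⟨⟨h1, h2⟩, hfl, r, hr, .inl hd, hp', hn'⟩
      · obtain ⟨f, rfl⟩ := D.dyn_head r hr q (by rw [hd]; rfl)
        exact .inr ⟨⟨h1, h2⟩, hfl, r, hr, .inr ⟨hd, hm⟩, hp', hn'⟩
    · simp [Rule.addLit, Rule.map, D.goal_head g hg, Head.map] at hd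
    · obtain ⟨rfl, hm⟩ : EncAtom.occ a T = p ∧ p ∈ M := by simpa using hd
      exact ⟨⟨h1, h2⟩, hm⟩
    · simp at hd
    · obtain rfl : EncAtom.flag T = p := by simpa using hd
      exact .inr ⟨⟨h1, h2⟩, .inl (hp _ (by simp))⟩
    · obtain ⟨rfl, hm⟩ : EncAtom.obs T = p ∧ p ∈ M := by simpa using hd
      exact ⟨⟨h1, h2⟩, hm⟩
    · obtain rfl : EncAtom.flag T = p := by simpa using hd
      exact .inr ⟨⟨h1, h2⟩, .inr (.inl ⟨a, f, hp _ (by simp), hp _ (by simp),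
        .inl ⟨hp _ (by simp), hn _ (by simp)⟩⟩)⟩
    · obtain rfl : EncAtom.flag T = p := by simpa using hd
      exact .inr ⟨⟨h1, h2⟩, .inr (.inl ⟨a, f, hp _ (by simp), hp _ (by simp),
        .inr ⟨hn _ (by simp), hp _ (by simp)⟩⟩)⟩
    · obtain rfl : EncAtom.flag T = p := by simpa using hd
      exact .inr ⟨⟨h1, h2⟩, .inr (.inr ⟨a, hp _ (by simp), hp _ (by simp),
        fun f => hn _ (by simp)⟩)⟩
  · intro h
    cases p with
    | t T =>
      exact ⟨fact _, .inl (.inl (.inl (.inl (.inl (.inl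
        ⟨_, .inl (.inl ⟨T, h.1, h.2, rfl⟩), rfl⟩))))), .inl rfl, by simp [fact], by simp [fact]⟩
    | action a =>
      exact ⟨fact _, .inl (.inl (.inl (.inl (.inl (.inl
        ⟨_, .inl (.inr ⟨a, rfl⟩), rfl⟩))))), .inl rfl, by simp [fact], by simp [fact]⟩
    | senses a f =>
      obtain ⟨x, rfl, rfl⟩ := h
      exact ⟨fact _, .inl (.inl (.inl (.inl (.inl (.inl
        ⟨_, .inr ⟨x, rfl⟩, rfl⟩))))), .inl rfl, by simp [fact], by simp [fact]⟩
    | occ a T =>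
      refine ⟨_, .inl (.inl (.inl (.inl (.inr (.inl ⟨T, h.1.1, h.1.2, a, rfl⟩))))),
        .inr ⟨rfl, h.2⟩, ?_, by simp⟩
      simpa using ⟨ht T h.1.1 h.1.2, ha a⟩
    | obs T =>
      refine ⟨_, .inl (.inl (.inr ⟨T, h.1.1, h.1.2, rfl⟩)), .inr ⟨rfl, h.2⟩, ?_, by simp⟩
      simpa using ht T h.1.1 h.1.2.le
    | h f T =>
      rcases h with ⟨rfl, r, hr, hd, hp, hn⟩ | ⟨⟨h1, h2⟩, hfl, r, hr, hd, hp, hn⟩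
      · refine ⟨_, .inl (.inl (.inl (.inl (.inl (.inr (.inl (.inl
          ⟨_, ⟨r, hr, rfl⟩, rfl⟩))))))), ?_, ?_, ?_⟩
        · rcases hd with hd | ⟨hd, hm⟩
          · simp [Rule.replaceBot, Rule.map, hd, Head.map, Head.replaceBot]
          · simp [Rule.replaceBot, Rule.map, hd, Head.map, Head.replaceBot, hm]
        · intro q hq
          obtain ⟨q, hq', rfl⟩ := pos_mem_map.1 hq
          exact hp q hq'
        · intro q hq
          obtain ⟨q, hq', rfl⟩ := neg_mem_map.1 hq
          exact hn q hq'
      · refine ⟨_, .inl (.inl (.inl (.inl (.inl (.inr (.inl (.inr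
          ⟨T, h1, h2, r, hr, rfl⟩))))))), ?_, ?_, ?_⟩
        · rcases hd with hd | ⟨hd, hm⟩
          · simp [Rule.addLit, Rule.map, hd, Head.map, dynAtomAt]
          · simp [Rule.addLit, Rule.map, hd, Head.map, dynAtomAt, hm]
        · rintro q (hq | hq | hq)
          · cases hq
          · cases hq
            exact ht T h1 h2
          · obtain ⟨q, hq', rfl⟩ := pos_mem_map.1 hq
            exact hp q hq'
        · rintro q (hq | hq | hq)
          · cases hq
            exact hfl
          · cases hq
          · obtain ⟨q, hq', rfl⟩ := neg_mem_map.1 hq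
            exact hn q hq'
    | flag T =>
      rcases h with ⟨rfl, r, hr, hd, hp, hn⟩ | ⟨⟨h1, h2⟩, h | ⟨a, f, ho, hs, h⟩ | ⟨a, ho, hb, hs⟩⟩
      · refine ⟨_, .inl (.inl (.inl (.inl (.inl (.inr (.inl (.inl
          ⟨_, ⟨r, hr, rfl⟩, rfl⟩))))))), ?_, ?_, ?_⟩
        · simp [Rule.replaceBot, Rule.map, hd, Head.map, Head.replaceBot]
        · intro q hq
          obtain ⟨q, hq', rfl⟩ := pos_mem_map.1 hq
          exact hp q hq'
        · intro q hq
          obtain ⟨q, hq', rfl⟩ := neg_mem_map.1 hq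
          exact hn q hq'
      · refine ⟨_, .inl (.inl (.inl (.inr ⟨T, h1, h2, rfl⟩))), .inl rfl, ?_, by simp⟩
        simpa using ⟨ht T h1 h2, h⟩
      · rcases h with ⟨hf, hb⟩ | ⟨hf, hb⟩
        · refine ⟨_, .inl (.inr (.inl ⟨T, h1, h2, a, f, rfl⟩)), .inl rfl, ?_, ?_⟩
          · simpa using ⟨ht T h1 h2, ho, hs, hf⟩
          · simpa using hb
        · refine ⟨_, .inl (.inr (.inr ⟨T, h1, h2, a, f, rfl⟩)), .inl rfl, ?_, ?_⟩
          · simpa using ⟨ht T h1 h2, ho, hs, hb⟩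
          · simpa using hf
      · refine ⟨_, .inr ⟨T, h1, h2, a, rfl⟩, .inl rfl, ?_, ?_⟩
        · simpa using ⟨ht T h1 h2, ho, hb⟩
        · simpa using hs

theorem derives_t {T : ℕ} (h1 : 1 ≤ T) (h2 : T ≤ n) :
    Derives (condProgram sensed D n) M M (.t T) :=
  .intro (fact (.t T)) (.inl (.inl (.inl (.inl (.inl (.inl
    ⟨_, .inl (.inl ⟨T, h1, h2, rfl⟩), rfl⟩)))))) _ (.inl rfl) (by simp [fact]) (by simp [fact])

theorem derives_action (a : N ⊕ S) : Derives (condProgram sensed D n) M M (.action a) :=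
  .intro (fact (.action a)) (.inl (.inl (.inl (.inl (.inl (.inl
    ⟨_, .inl (.inr ⟨a, rfl⟩), rfl⟩)))))) _ (.inl rfl) (by simp [fact]) (by simp [fact])

theorem derives_condProgram_iff {p : EncAtom F N S} :
    Derives (condProgram sensed D n) M M p ↔
      Support sensed D n {q | Derives (condProgram sensed D n) M M q} M p :=
  derives_iff.trans (fires_condProgram_iff (fun _ => derives_t) derives_action)

/-- The rules of the encoding with head `⊥` are the dynamic and goal constraints and those that
exclude two simultaneous actions. -/
theorem violated_condProgram_iff (hcl : (condProgram sensed D n).IsClosed M) :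
    (condProgram sensed D n).Violated M ↔
      (∃ T, (1 ≤ T ∧ T ≤ n) ∧ .flag T ∉ M ∧ D.dyn.Violated (dynAtomAt T ⁻¹' M)) ∨
      (.flag n ∉ M ∧ D.goal.Violated {f | .h f n ∈ M}) ∨
      ∃ T, (1 ≤ T ∧ T ≤ n) ∧ ¬ {a | .occ a T ∈ M}.Subsingleton := by
  have ht : ∀ T, 1 ≤ T → T ≤ n → .t T ∈ M := fun T h1 h2 =>
    (hcl _).2 (derives_t h1 h2)
  have ha : ∀ a, .action a ∈ M := fun a => (hcl _).2 (derives_action a)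
  constructor
  · rintro ⟨r, hr, hd, hb⟩
    rcases hr with ((((((⟨_, -, rfl⟩) |
      ((⟨_, ⟨r, hr, rfl⟩, rfl⟩ | ⟨T, h1, h2, r, hr, rfl⟩) | ⟨g, hg, rfl⟩)) |
      (⟨T, h1, h2, a, rfl⟩ | ⟨T, h1, h2, a, b, hab, rfl⟩)) | ⟨T, h1, h2, rfl⟩) |
      ⟨T, h1, h2, rfl⟩) | (⟨T, h1, h2, a, f, rfl⟩ | ⟨T, h1, h2, a, f, rfl⟩)) |
      ⟨T, h1, h2, a, rfl⟩
    · simp [fact] at hd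
    · exact absurd hd Head.replaceBot_ne_bot
    · exact .inl ⟨T, ⟨h1, h2⟩, hb _ (.inl rfl), r, hr, Head.map_eq_bot.1 hd,
        fun l hl => Literal.holds_map.1 (hb _ (.inr (.inr ⟨l, hl, rfl⟩)))⟩
    · exact .inr (.inl ⟨hb _ (.inl rfl), g, hg, D.goal_head g hg,
        fun l hl => Literal.holds_map.1 (hb _ (.inr ⟨l, hl, rfl⟩))⟩)
    · simp at hd
    · refine .inr (.inr ⟨T, ⟨h1, h2⟩, fun hs => hab ?_⟩)
      exact hs (hb (.pos (.occ a T)) (by simp)) (hb (.pos (.occ b T)) (by simp))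
    all_goals simp at hd
  · rintro (⟨T, ⟨h1, h2⟩, hfl, r, hr, hd, hb⟩ | ⟨hfl, g, hg, hd, hb⟩ | ⟨T, ⟨h1, h2⟩, hs⟩)
    · refine ⟨_, .inl (.inl (.inl (.inl (.inl (.inr (.inl (.inr
          ⟨T, h1, h2, r, hr, rfl⟩))))))), ?_, ?_⟩
      · simp [Rule.addLit, Rule.map, hd, Head.map]
      · rintro l (rfl | rfl | ⟨l, hl, rfl⟩)
        · exact hfl
        · exact ht T h1 h2
        · exact Literal.holds_map.2 (hb l hl)
    · refine ⟨_, .inl (.inl (.inl (.inl (.inl (.inr (.inr ⟨g, hg, rfl⟩)))))), ?_, ?_⟩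
      · simp [Rule.addLit, Rule.map, hd, Head.map]
      · rintro l (rfl | ⟨l, hl, rfl⟩)
        · exact hfl
        · exact Literal.holds_map.2 (hb l hl)
    · rw [Set.not_subsingleton_iff] at hs
      obtain ⟨a, ha1, b, hb1, hab⟩ := hs
      refine ⟨_, .inl (.inl (.inl (.inl (.inr (.inr ⟨T, h1, h2, a, b, hab, rfl⟩))))), rfl, ?_⟩
      rintro l (rfl | rfl | rfl | rfl | rfl)
      exacts [ht T h1 h2, ha a, ha b, ha1, hb1]

end Planning

/-! ### Stable models of the encoding -/

namespace Planning

open ASP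

universe u v w

variable {F : Type u} {N : Type v} {S : Type w}
variable {sensed : S → F} {D : Description F N S} {n : ℕ} {M : Set (EncAtom F N S)}

/-- The state at time `T` in a set of atoms of the encoding. -/
def stateAt (M : Set (EncAtom F N S)) (T : ℕ) : Set F := {f | .h f T ∈ M}

/-- The actions and the announced observation at time `T` in a set of atoms of the encoding. -/
def choiceAt (M : Set (EncAtom F N S)) (T : ℕ) : Set (N ⊕ S) × Prop :=
  ({a | .occ a T ∈ M}, .obs T ∈ M)

theorem preimage_dynAtomAt (T : ℕ) : (dynAtomAt (T + 1) ⁻¹' M : Set (DynAtom F N S)) =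
    stepModel (stateAt M T) (choiceAt M (T + 1)).1 (stateAt M (T + 1)) := by
  ext p
  cases p <;> rfl

/-- At time `0`, the encoding derives the same fluents as the initial rules. -/
theorem derives_h_zero_iff {f : F} : Derives (condProgram sensed D n) M M (.h f 0) ↔
    Derives D.init (stateAt M 0) (stateAt M 0) f := by
  constructor
  · intro h
    have H := h.induct (V := {p | ∀ g, p = .h g 0 → Derives D.init (stateAt M 0) (stateAt M 0) g})
      (fun p hp => ?_)
    · exact H f rfl
    · rintro g rfl
      replace hp := (fires_condProgram_iff (by exact fun T h1 h2 => ⟨derives_t h1 h2, by simp⟩)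
        (by exact fun a => ⟨derives_action a, by simp⟩)).1 hp
      rcases hp with ⟨-, r, hr, hd, hp, hn⟩ | ⟨⟨h1, -⟩, -⟩
      · exact .intro r hr g hd (fun q hq => (hp q hq).2 q rfl) hn
      · omega
  · intro h
    induction h with
    | intro r hr g hd hp hn ih => exact derives_condProgram_iff.2 (.inl ⟨rfl, r, hr, hd, ih, hn⟩)

/-- At later times, the encoding derives the same fluents as the dynamic rules, unless the flag is
raised. -/
theorem derives_h_succ_iff {T : ℕ} (hT : T + 1 ≤ n) (hfl : .flag (T + 1) ∉ M)
    (hprev : ∀ f, f ∈ stateAt M T ↔ Derives (condProgram sensed D n) M M (.h f T)) {f : F} :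
    Derives (condProgram sensed D n) M M (.h f (T + 1)) ↔
      Derives (multiStepProgram D (stateAt M T) (choiceAt M (T + 1)).1)
        (dynAtomAt (T + 1) ⁻¹' M) (dynAtomAt (T + 1) ⁻¹' M) (.fluent f) := by
  constructor
  · intro h
    have H := h.induct (V := {p | ∀ g, p = .h g (T + 1) →
      Derives (multiStepProgram D (stateAt M T) (choiceAt M (T + 1)).1)
        (dynAtomAt (T + 1) ⁻¹' M) (dynAtomAt (T + 1) ⁻¹' M) (.fluent g)}) (fun p hp => ?_)
    · exact H f rfl
    · rintro g rfl
      replace hp := (fires_condProgram_iff (by exact fun T h1 h2 => ⟨derives_t h1 h2, by simp⟩)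
        (by exact fun a => ⟨derives_action a, by simp⟩)).1 hp
      rcases hp with ⟨h0, -⟩ | ⟨-, -, r, hr, hd, hp, hn⟩
      · omega
      · refine .intro r (.inr hr) _ hd (fun q hq => ?_) hn
        cases q with
        | fluent q => exact (hp _ hq).2 q rfl
        | prev q => exact derives_prev ((hprev q).2 (hp _ hq).1)
        | action a => exact derives_occurs (derives_condProgram_iff.1 (hp _ hq).1).2
  · suffices H : ∀ p, Derives (multiStepProgram D (stateAt M T) (choiceAt M (T + 1)).1)
        (dynAtomAt (T + 1) ⁻¹' M) (dynAtomAt (T + 1) ⁻¹' M) p →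
          Derives (condProgram sensed D n) M M (dynAtomAt (T + 1) p) from H _
    intro p h
    induction h with
    | intro r hr p hd hp hn ih =>
      cases p with
      | prev g => exact (hprev g).1 (mem_of_derives_prev (.intro r hr _ hd hp hn))
      | action a =>
        exact derives_condProgram_iff.2
          ⟨⟨by omega, hT⟩, mem_of_derives_occurs (.intro r hr _ hd hp hn)⟩
      | fluent g =>
        rcases hr with (⟨_, ⟨g, hg, rfl⟩, rfl⟩ | ⟨_, ⟨a, ha, rfl⟩, rfl⟩) | hr
        · simp [fact] at hd
        · simp [fact] at hd
        · exact derives_condProgram_iff.2 (.inr ⟨⟨by omega, hT⟩, hfl, r, hr, hd, ih, hn⟩)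

/-- The conditions, for each kind of atoms, that describe the closed sets of the encoding. -/
structure EncClosed (sensed : S → F) (D : Description F N S) (n : ℕ)
    (M : Set (EncAtom F N S)) : Prop where
  t : ∀ T, .t T ∈ M ↔ 1 ≤ T ∧ T ≤ n
  action : ∀ a, .action a ∈ M
  senses : ∀ a f, .senses a f ∈ M ↔ ∃ x, a = .inr x ∧ f = sensed x
  occ : ∀ a T, .occ a T ∈ M → 1 ≤ T ∧ T ≤ n
  obs : ∀ T, .obs T ∈ M → 1 ≤ T ∧ T < n
  init : D.init.IsClosed (stateAt M 0)
  flag_zero : .flag 0 ∈ M ↔ D.init.Violated (stateAt M 0)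
  flag_succ : ∀ T, .flag (T + 1) ∈ M ↔ T + 1 ≤ n ∧ (.flag T ∈ M ∨
    Mismatch sensed (choiceAt M T) (stateAt M T) ∨ Idle (choiceAt M (T + 1)))
  step : ∀ T, T + 1 ≤ n → .flag (T + 1) ∉ M →
    (multiStepProgram D (stateAt M T) (choiceAt M (T + 1)).1).IsClosed (dynAtomAt (T + 1) ⁻¹' M)
  state_flag : ∀ T, .flag (T + 1) ∈ M → stateAt M (T + 1) = ∅
  state_lt : ∀ T, n < T → stateAt M T = ∅

theorem support_flag_zero_iff (V : Set (EncAtom F N S)) (hV : ∀ q, .h q 0 ∈ V ↔ .h q 0 ∈ M) :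
    Support sensed D n V M (.flag 0) ↔ D.init.Violated (stateAt M 0) := by
  constructor
  · rintro (⟨-, r, hr, hd, hp, hn⟩ | ⟨⟨h1, -⟩, -⟩)
    · exact ⟨r, hr, hd, holds_body (fun q hq => (hV q).1 (hp q hq)) hn⟩
    · omega
  · rintro ⟨r, hr, hd, hb⟩
    exact .inl ⟨rfl, r, hr, hd, fun q hq => (hV q).2 (hb _ hq), fun q hq => hb _ hq⟩

theorem support_flag_succ_iff {V : Set (EncAtom F N S)} {T : ℕ}
    (hM : ∀ a f, .senses a f ∈ M ↔ ∃ x, a = .inr x ∧ f = sensed x)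
    (hs : ∀ a f, .senses a f ∈ V ↔ ∃ x, a = .inr x ∧ f = sensed x)
    (ho : ∀ a T, .occ a T ∈ V ↔ .occ a T ∈ M) (hb : ∀ T, .obs T ∈ V ↔ .obs T ∈ M)
    (hh : ∀ q, .h q T ∈ V ↔ .h q T ∈ M) (hf : .flag T ∈ V ↔ .flag T ∈ M) :
    Support sensed D n V M (.flag (T + 1)) ↔ T + 1 ≤ n ∧ (.flag T ∈ M ∨
      Mismatch sensed (choiceAt M T) (stateAt M T) ∨ Idle (choiceAt M (T + 1))) := by
  have hmis : Mismatch sensed (choiceAt M T) (stateAt M T) ↔ ∃ a f, .occ a T ∈ V ∧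
      .senses a f ∈ V ∧ (.h f T ∈ V ∧ .obs T ∉ M ∨ .h f T ∉ M ∧ .obs T ∈ V) := by
    simp only [hs, ho, hb, hh]
    constructor
    · rintro ⟨x, hx, hn⟩
      refine ⟨.inr x, sensed x, hx, ⟨x, rfl, rfl⟩, ?_⟩
      change ¬ (.h (sensed x) T ∈ M ↔ .obs T ∈ M) at hn
      tauto
    · rintro ⟨_, _, hx, ⟨x, rfl, rfl⟩, hn⟩
      refine ⟨x, hx, ?_⟩
      change ¬ (.h (sensed x) T ∈ M ↔ .obs T ∈ M)
      tauto
  have hidle : Idle (choiceAt M (T + 1)) ↔ ∃ a, .occ a (T + 1) ∈ V ∧ .obs (T + 1) ∈ V ∧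
      ∀ f, .senses a f ∉ M := by
    simp only [hM, ho, hb]
    constructor
    · rintro ⟨hobs, x, hx⟩
      exact ⟨.inl x, hx, hobs, by simp⟩
    · rintro ⟨x | x, hx, hobs, hn⟩
      · exact ⟨hobs, x, hx⟩
      · exact absurd ⟨x, rfl, rfl⟩ (hn (sensed x))
  rw [hmis, hidle, ← hf]
  constructor
  · rintro (⟨h0, -⟩ | ⟨⟨-, hT⟩, h⟩)
    · omega
    · exact ⟨hT, h⟩
  · rintro ⟨hT, h⟩
    exact .inr ⟨⟨by omega, hT⟩, h⟩

theorem isClosed_condProgram_iff :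
    (condProgram sensed D n).IsClosed M ↔ EncClosed sensed D n M := by
  constructor
  · intro hcl
    have hsupp : ∀ p, p ∈ M ↔ Support sensed D n M M p := by
      intro p
      have hV : {q | Derives (condProgram sensed D n) M M q} = M :=
        Set.ext fun q => (hcl q).symm
      rw [hcl p, derives_condProgram_iff, hV]
    have hsenses : ∀ a f, .senses a f ∈ M ↔ ∃ x, a = .inr x ∧ f = sensed x :=
      fun a f => hsupp _
    refine ⟨fun T => hsupp _, fun a => (hsupp _).2 trivial, hsenses,
      fun a T h => ((hsupp _).1 h).1, fun T h => ((hsupp _).1 h).1,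
      fun f => (hcl (.h f 0)).trans derives_h_zero_iff,
      (hsupp _).trans (support_flag_zero_iff M fun _ => Iff.rfl),
      fun T => (hsupp _).trans (support_flag_succ_iff hsenses hsenses (fun _ _ => Iff.rfl)
        (fun _ => Iff.rfl) (fun _ => Iff.rfl) Iff.rfl), fun T hT hfl p => ?_, fun T hT => ?_,
      fun T hT => ?_⟩
    · cases p with
      | prev f => exact (⟨fun h => derives_prev h, mem_of_derives_prev⟩ : f ∈ stateAt M T ↔ _)
      | action a => exact (⟨fun h => derives_occurs h, mem_of_derives_occurs⟩ :
          a ∈ (choiceAt M (T + 1)).1 ↔ _)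
      | fluent f => exact (hcl _).trans (derives_h_succ_iff hT hfl fun f => hcl _)
    · refine Set.eq_empty_iff_forall_notMem.2 fun f hf => ?_
      rcases (hsupp _).1 hf with ⟨h0, -⟩ | ⟨-, hfl, -⟩
      · omega
      · exact hfl hT
    · refine Set.eq_empty_iff_forall_notMem.2 fun f hf => ?_
      rcases (hsupp _).1 hf with ⟨h0, -⟩ | ⟨⟨-, h⟩, -⟩ <;> omega
  · intro h
    have hocc : ∀ a T, .occ a T ∈ M ↔ Derives (condProgram sensed D n) M M (.occ a T) :=
      fun a T => ⟨fun ha => derives_condProgram_iff.2 ⟨h.occ a T ha, ha⟩,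
        fun ha => (derives_condProgram_iff.1 ha).2⟩
    have hobs : ∀ T, .obs T ∈ M ↔ Derives (condProgram sensed D n) M M (.obs T) :=
      fun T => ⟨fun ha => derives_condProgram_iff.2 ⟨h.obs T ha, ha⟩,
        fun ha => (derives_condProgram_iff.1 ha).2⟩
    have htime : ∀ T, (∀ f, .h f T ∈ M ↔ Derives (condProgram sensed D n) M M (.h f T)) ∧
        (.flag T ∈ M ↔ Derives (condProgram sensed D n) M M (.flag T)) := by
      intro T
      induction T with
      | zero =>
        have h0 : ∀ f, .h f 0 ∈ M ↔ Derives (condProgram sensed D n) M M (.h f 0) :=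
          fun f => (h.init f).trans derives_h_zero_iff.symm
        refine ⟨h0, ?_⟩
        exact h.flag_zero.trans ((support_flag_zero_iff _ fun q => (h0 q).symm).symm.trans
          derives_condProgram_iff.symm)
      | succ T ih =>
        constructor
        · intro f
          by_cases hT : T + 1 ≤ n
          · by_cases hfl : .flag (T + 1) ∈ M
            · refine iff_of_false (fun hf => ?_) fun hf => ?_
              · have : f ∈ stateAt M (T + 1) := hf
                rw [h.state_flag T hfl] at this
                exact this
              · rcases derives_condProgram_iff.1 hf with ⟨h0, -⟩ | ⟨-, hn, -⟩
                · omega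
                · exact hn hfl
            · rw [derives_h_succ_iff hT hfl ih.1]
              exact h.step T hT hfl (.fluent f)
          · refine iff_of_false (fun hf => ?_) fun hf => ?_
            · have : f ∈ stateAt M (T + 1) := hf
              rw [h.state_lt (T + 1) (by omega)] at this
              exact this
            · rcases derives_condProgram_iff.1 hf with ⟨h0, -⟩ | ⟨⟨-, hn⟩, -⟩ <;> omega
        · exact (h.flag_succ T).trans ((support_flag_succ_iff h.senses
            (fun a f => derives_condProgram_iff (p := .senses a f)) (fun a T => (hocc a T).symm)
            (fun T => (hobs T).symm) (fun q => (ih.1 q).symm) ih.2.symm).symm.trans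
            derives_condProgram_iff.symm)
    intro p
    cases p with
    | t T => exact (h.t T).trans (derives_condProgram_iff (p := .t T)).symm
    | action a => exact iff_of_true (h.action a) (derives_action a)
    | senses a f => exact (h.senses a f).trans (derives_condProgram_iff (p := .senses a f)).symm
    | occ a T => exact hocc a T
    | obs T => exact hobs T
    | h f T => exact (htime T).1 f
    | flag T => exact (htime T).2

/-! ### Trajectories -/

/-- The sequences of states `st` and of flags `fl` are the ones that the encoding computes up to
time `m` for the actions and observations in `e`, and the goal is satisfied at time `m`. -/
def Trajectory (sensed : S → F) (D : Description F N S) (G : Set (Set F)) (m : ℕ)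
    (e : ℕ → Set (N ⊕ S) × Prop) (st : ℕ → Set F) (fl : ℕ → Prop) : Prop :=
  (∀ T < m, (fl (T + 1) ↔ fl T ∨ Mismatch sensed (e T) (st T) ∨ Idle (e (T + 1))) ∧
    (fl (T + 1) → st (T + 1) = ∅) ∧
    (¬ fl (T + 1) → Step D (st T) (e (T + 1)).1 (st (T + 1)))) ∧ (¬ fl m → st m ∈ G)

theorem trajectory_succ_iff {G : Set (Set F)} {m : ℕ}
    {e : ℕ → Set (N ⊕ S) × Prop} {st : ℕ → Set F} {fl : ℕ → Prop} :
    Trajectory sensed D G (m + 1) e st fl ↔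
      ((fl 1 ↔ fl 0 ∨ Mismatch sensed (e 0) (st 0) ∨ Idle (e 1)) ∧ (fl 1 → st 1 = ∅) ∧
        (¬ fl 1 → Step D (st 0) (e 1).1 (st 1))) ∧
      Trajectory sensed D G m (fun T => e (T + 1)) (fun T => st (T + 1)) fun T => fl (T + 1) := by
  unfold Trajectory
  rw [← and_assoc]
  refine and_congr ⟨fun h => ⟨h 0 (by omega), fun T hT => h (T + 1) (by omega)⟩,
    fun h T hT => ?_⟩ Iff.rfl
  cases T with
  | zero => exact h.1
  | succ T => exact h.2 T (by omega)

/-- Once the flag is raised, nothing can prevent a stable model. -/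
theorem exists_trajectory_of_flag {G : Set (Set F)} {m : ℕ}
    {e : ℕ → Set (N ⊕ S) × Prop} (s : Set F) :
    ∃ st fl, st 0 = s ∧ fl 0 ∧ Trajectory sensed D G m e st fl :=
  ⟨scons s fun _ => ∅, fun _ => True, rfl, trivial,
    fun _ _ => ⟨iff_of_true trivial (.inl trivial), fun _ => rfl, fun h => absurd trivial h⟩,
    fun h => absurd trivial h⟩

theorem exists_trajectory_iff {G : Set (Set F)} {m : ℕ}
    {e : ℕ → Set (N ⊕ S) × Prop} {s : Set F} :
    (∃ st fl, st 0 = s ∧ ¬ fl 0 ∧ Trajectory sensed D G m e st fl) ↔ Run sensed D G m e s := by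
  induction m generalizing e s with
  | zero =>
    constructor
    · rintro ⟨st, fl, rfl, hfl, h⟩
      exact h.2 hfl
    · exact fun h => ⟨fun _ => s, fun _ => False, rfl, id, fun T hT => by omega, fun _ => h⟩
  | succ m ih =>
    constructor
    · rintro ⟨st, fl, rfl, hfl, h⟩
      obtain ⟨⟨h1, -, h3⟩, h⟩ := trajectory_succ_iff.1 h
      by_cases hf : fl 1
      · rcases (h1.1 hf).resolve_left hfl with h | h
        · exact .inl h
        · exact .inr (.inl h)
      · exact .inr (.inr ⟨st 1, h3 hf, ih.1 ⟨_, _, rfl, hf, h⟩⟩)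
    · intro h
      by_cases hf : Mismatch sensed (e 0) s ∨ Idle (e 1)
      · obtain ⟨st, fl, h0, hfl, h⟩ := exists_trajectory_of_flag (sensed := sensed) (D := D)
          (G := G) (m := m) (e := fun T => e (T + 1)) ∅
        exact ⟨scons s st, scons False fl, rfl, id, trajectory_succ_iff.2
          ⟨⟨iff_of_true hfl (.inr hf), fun _ => h0, fun h => absurd hfl h⟩, h⟩⟩
      · obtain ⟨t, ht, hrun⟩ := (h.resolve_left fun h => hf (.inl h)).resolve_left
          fun h => hf (.inr h)
        obtain ⟨st, fl, rfl, hfl, h⟩ := ih.2 hrun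
        exact ⟨scons s st, scons False fl, rfl, id, trajectory_succ_iff.2
          ⟨⟨iff_of_false hfl (not_or.2 ⟨id, hf⟩), fun h => absurd h hfl, fun _ => ht⟩, h⟩⟩

/-- The set of atoms of the encoding given by actions and observations, states and flags. -/
def encModel (sensed : S → F) (n : ℕ) (e : ℕ → Set (N ⊕ S) × Prop) (st : ℕ → Set F)
    (fl : ℕ → Prop) : Set (EncAtom F N S) :=
  {p | match p with
    | .t T => 1 ≤ T ∧ T ≤ n
    | .action _ => True
    | .senses a f => ∃ x, a = .inr x ∧ f = sensed x
    | .occ a T => (1 ≤ T ∧ T ≤ n) ∧ a ∈ (e T).1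
    | .obs T => (1 ≤ T ∧ T < n) ∧ (e T).2
    | .h f T => T ≤ n ∧ f ∈ st T
    | .flag T => T ≤ n ∧ fl T}

theorem mem_goal_iff {s : Set F} :
    s ∈ (choices Set.univ ∪ D.goal : Program F).SM ↔ ¬ D.goal.Violated s := by
  change Program.IsStable _ _ ↔ _
  rw [isStable_iff]
  have hcl : (choices Set.univ ∪ D.goal : Program F).IsClosed s := by
    intro p
    constructor
    · exact fun hp => .intro ⟨.choice p, ∅⟩ (.inl ⟨p, trivial, rfl⟩) p (.inr ⟨rfl, hp⟩)
        (by simp) (by simp)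
    · rintro ⟨r, ⟨q, -, rfl⟩ | hr, _, hd, -, -⟩
      · obtain ⟨rfl, hp⟩ : q = p ∧ p ∈ s := by simpa using hd
        exact hp
      · simp [D.goal_head r hr] at hd
  have hv : (choices Set.univ ∪ D.goal : Program F).Violated s ↔ D.goal.Violated s := by
    constructor
    · rintro ⟨r, ⟨q, -, rfl⟩ | hr, hd, hb⟩
      · simp at hd
      · exact ⟨r, hr, hd, hb⟩
    · rintro ⟨r, hr, hd, hb⟩
      exact ⟨r, .inr hr, hd, hb⟩
  rw [hv]
  exact and_iff_right hcl

theorem choice_mem_encInit_iff {f : F} :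
    (⟨.choice (.h f 0), ∅⟩ : Rule (EncAtom F N S)) ∈ encInit D ↔
      (⟨.choice f, ∅⟩ : Rule F) ∈ D.init := by
  constructor
  · rintro ⟨⟨hd, b⟩, hr, h⟩
    simp only [Rule.map, Rule.mk.injEq, Set.image_eq_empty, Head.map_eq_choice,
      EncAtom.h.injEq, and_true] at h
    obtain ⟨⟨g, rfl, rfl⟩, rfl⟩ := h
    exact hr
  · exact fun h => ⟨_, h, by simp [Rule.map, Head.map]⟩

/-- Stable models of the encoding are trajectories that start in a closed set of the initial
rules. At time `0` no action is chosen, and at time `n` nothing is observed. -/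
theorem exists_isStable_iff {e : ℕ → Set (N ⊕ S) × Prop} (he : e 0 = (∅, False))
    (hen : ¬ (e n).2) (s : Set F) :
    (∃ M, (condProgram sensed D n).IsStable M ∧
        (∀ T, 1 ≤ T → T ≤ n → ∀ a, .occ a T ∈ M ↔ a ∈ (e T).1) ∧
        (∀ T, 1 ≤ T → T < n → (.obs T ∈ M ↔ (e T).2)) ∧ stateAt M 0 = s) ↔
      (∀ T, 1 ≤ T → T ≤ n → (e T).1.Subsingleton) ∧ D.init.IsClosed s ∧
        (D.init.Violated s ∨ Run sensed D {t | ¬ D.goal.Violated t} n e s) := by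
  constructor
  · rintro ⟨M, hM, hocc, hobs, rfl⟩
    obtain ⟨hcl, hv⟩ := isStable_iff.1 hM
    rw [violated_condProgram_iff hcl, not_or, not_or] at hv
    obtain ⟨hdyn, hgoal, hsub⟩ := hv
    have h := isClosed_condProgram_iff.1 hcl
    have hchoice : ∀ T ≤ n, choiceAt M T = e T := by
      intro T hT
      refine Prod.ext (Set.ext fun a => ?_) (propext ?_)
      · rcases Nat.eq_zero_or_pos T with rfl | h1
        · rw [he]
          exact iff_of_false (fun ha => absurd (h.occ a 0 ha).1 (by omega)) id
        · exact hocc T h1 hT a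
      · rcases Nat.eq_zero_or_pos T with rfl | h1
        · rw [he]
          exact iff_of_false (fun ha => absurd (h.obs 0 ha).1 (by omega)) id
        · rcases hT.lt_or_eq with hT | rfl
          · exact hobs T h1 hT
          · exact iff_of_false (fun ha => absurd (h.obs T ha).2 (by omega)) hen
    refine ⟨fun T h1 h2 => ?_, h.init, or_iff_not_imp_left.2 fun hfl => ?_⟩
    · by_contra hn
      refine hsub ⟨T, ⟨h1, h2⟩, ?_⟩
      change ¬ (choiceAt M T).1.Subsingleton
      rwa [hchoice T h2]
    · rw [← h.flag_zero] at hfl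
      refine exists_trajectory_iff.1 ⟨stateAt M, fun T => .flag T ∈ M, rfl, hfl,
        fun T hT => ⟨?_, h.state_flag T, fun hf => ?_⟩, fun hf => ?_⟩
      · rw [← hchoice T (by omega), ← hchoice (T + 1) hT]
        exact (h.flag_succ T).trans (and_iff_right hT)
      · rw [← hchoice (T + 1) hT]
        refine isStable_iff.2 ?_
        rw [← preimage_dynAtomAt, violated_multiStepProgram_iff]
        exact ⟨h.step T hT hf, fun hd => hdyn ⟨T + 1, ⟨by omega, hT⟩, hf, hd⟩⟩
      · exact fun hg => hgoal ⟨hf, hg⟩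
  · rintro ⟨hsub, hinit, hrun⟩
    obtain ⟨st, fl, rfl, hfl, htr, hgoal⟩ : ∃ st fl, st 0 = s ∧ (fl 0 ↔ D.init.Violated s) ∧
        Trajectory sensed D {t | ¬ D.goal.Violated t} n e st fl := by
      by_cases hv : D.init.Violated s
      · obtain ⟨st, fl, h0, hf, h⟩ := exists_trajectory_of_flag (sensed := sensed) (D := D)
          (G := {t | ¬ D.goal.Violated t}) (m := n) (e := e) s
        exact ⟨st, fl, h0, iff_of_true hf hv, h⟩
      · obtain ⟨st, fl, h0, hf, h⟩ := exists_trajectory_iff.2 (hrun.resolve_left hv)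
        exact ⟨st, fl, h0, iff_of_false hf hv, h⟩
    have hstate : ∀ T ≤ n, stateAt (encModel sensed n e st fl) T = st T := fun T hT =>
      Set.ext fun f => and_iff_right hT
    have hflag : ∀ T ≤ n, .flag T ∈ encModel sensed n e st fl ↔ fl T := fun T hT =>
      and_iff_right hT
    have hchoice : ∀ T ≤ n, choiceAt (encModel sensed n e st fl) T = e T := by
      intro T hT
      refine Prod.ext (Set.ext fun a => ?_) (propext ?_)
      · change (1 ≤ T ∧ T ≤ n) ∧ a ∈ (e T).1 ↔ _
        rcases Nat.eq_zero_or_pos T with rfl | h1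
        · simp [he]
        · exact and_iff_right ⟨h1, hT⟩
      · change (1 ≤ T ∧ T < n) ∧ (e T).2 ↔ _
        rcases Nat.eq_zero_or_pos T with rfl | h1
        · simp [he]
        · rcases hT.lt_or_eq with hT | rfl
          · exact and_iff_right ⟨h1, hT⟩
          · simp [hen]
    have hstep : ∀ T, T + 1 ≤ n → .flag (T + 1) ∉ encModel sensed n e st fl →
        (multiStepProgram D (stateAt (encModel sensed n e st fl) T)
          (choiceAt (encModel sensed n e st fl) (T + 1)).1).IsStable
            (dynAtomAt (T + 1) ⁻¹' encModel sensed n e st fl) := by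
      intro T hT hf
      rw [hflag _ hT] at hf
      rw [preimage_dynAtomAt, hstate T (by omega), hchoice _ hT, hstate _ hT]
      exact (htr T hT).2.2 hf
    have hcl : (condProgram sensed D n).IsClosed (encModel sensed n e st fl) := by
      refine isClosed_condProgram_iff.2 ⟨fun T => Iff.rfl, fun a => trivial, fun a f => Iff.rfl,
        fun a T h => h.1, fun T h => h.1, ?_, ?_, fun T => ?_,
        fun T hT hf => (isStable_iff.1 (hstep T hT hf)).1, fun T hf => ?_, fun T hT => ?_⟩
      · rwa [hstate 0 (Nat.zero_le _)]
      · rw [hstate 0 (Nat.zero_le _), hflag 0 (Nat.zero_le _), hfl]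
      · by_cases hT : T + 1 ≤ n
        · rw [hflag _ hT, hflag T (by omega), hchoice T (by omega), hchoice _ hT,
            hstate T (by omega), (htr T hT).1]
          exact (and_iff_right hT).symm
        · exact iff_of_false (fun h => hT h.1) fun h => hT h.1
      · have hT : T + 1 ≤ n := hf.1
        rw [hstate _ hT]
        exact (htr T hT).2.1 hf.2
      · exact Set.eq_empty_iff_forall_notMem.2 fun f hf => absurd hf.1 (by omega)
    refine ⟨encModel sensed n e st fl, isStable_iff.2 ⟨hcl, ?_⟩,
      fun T h1 h2 a => and_iff_right ⟨h1, h2⟩, fun T h1 h2 => and_iff_right ⟨h1, h2⟩,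
      hstate 0 (Nat.zero_le _)⟩
    rw [violated_condProgram_iff hcl]
    rintro (⟨T, ⟨h1, h2⟩, hf, hd⟩ | ⟨hf, hg⟩ | ⟨T, ⟨h1, h2⟩, hs⟩)
    · obtain ⟨T, rfl⟩ := Nat.exists_eq_succ_of_ne_zero (by omega : T ≠ 0)
      exact (isStable_iff.1 (hstep T h2 hf)).2 (violated_multiStepProgram_iff.2 hd)
    · refine hgoal (fun h => hf ((hflag n le_rfl).2 h)) ?_
      rwa [← hstate n le_rfl]
    · refine hs ?_
      change (choiceAt (encModel sensed n e st fl) T).1.Subsingleton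
      rw [hchoice T h2]
      exact hsub T h1 h2

/-! ### The quantifier prefix as a game -/

theorem inter_occSet_iff {T : ℕ} {Y : Set (EncAtom F N S)} (hY : Y ⊆ occSet T) :
    M ∩ occSet T = Y ↔ ∀ a, .occ a T ∈ M ↔ .occ a T ∈ Y := by
  constructor
  · rintro rfl a
    exact ⟨fun h => ⟨h, a, rfl⟩, fun h => h.1⟩
  · intro h
    ext p
    constructor
    · rintro ⟨hp, a, rfl⟩
      exact (h a).1 hp
    · intro hp
      obtain ⟨a, rfl⟩ := hY hp
      exact ⟨(h a).2 hp, a, rfl⟩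

theorem inter_obsSet_iff {T : ℕ} {Y : Set (EncAtom F N S)} (hY : Y ⊆ obsSet T) :
    M ∩ obsSet T = Y ↔ (.obs T ∈ M ↔ .obs T ∈ Y) := by
  constructor
  · rintro rfl
    exact ⟨fun h => ⟨h, rfl⟩, fun h => h.1⟩
  · intro h
    ext p
    constructor
    · rintro ⟨hp, rfl⟩
      exact h.1 hp
    · intro hp
      obtain rfl := hY hp
      exact ⟨h.2 hp, rfl⟩

/-- A stable model of `P` with prescribed actions from time `i` to `i + m`, observations from time
`i` to `i + m - 1`, and open fluents. -/
def HasModel (D : Description F N S) (P : Program (EncAtom F N S)) (i m : ℕ)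
    (e : ℕ → Set (N ⊕ S) × Prop) (Y : Set (EncAtom F N S)) : Prop :=
  ∃ M, P.IsStable M ∧ (∀ T ≤ m, ∀ a, .occ a (i + T) ∈ M ↔ a ∈ (e T).1) ∧
    (∀ T < m, .obs (i + T) ∈ M ↔ (e T).2) ∧ M ∩ openSet D = Y

theorem qsat_iff_game (P : Program (EncAtom F N S)) (i m : ℕ) :
    QSat ((List.range' i m).flatMap
        (fun i => [(Quantifier.ex, occSet (i + 1)), (Quantifier.all, obsSet (i + 1))]) ++
        [(Quantifier.ex, occSet (i + m + 1)), (Quantifier.all, openSet D)]) P ↔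
      Game m fun e => ∀ Y ⊆ openSet D, HasModel D P (i + 1) m e Y := by
  induction m generalizing i P with
  | zero =>
    have key : ∀ Y : Set (EncAtom F N S), Y ⊆ occSet (i + 1) → ∀ Z ⊆ openSet D,
        (QSat [] (P ∪ fixcons Y (occSet (i + 1)) ∪ fixcons Z (openSet D)) ↔
          HasModel D P (i + 1) 0 (fun _ => ({a | .occ a (i + 1) ∈ Y}, False)) Z) := by
      intro Y hY Z hZ
      simp only [QSat, HasModel, isStable_union_fixcons hZ, isStable_union_fixcons hY,
        inter_occSet_iff hY, and_assoc, Nat.le_zero, forall_eq, Nat.not_lt_zero,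
        Set.mem_ofPred_eq, add_zero, false_imp_iff, implies_true, true_and]
    constructor
    · rintro ⟨Y, hY, h⟩
      exact ⟨{a | .occ a (i + 1) ∈ Y}, fun Z hZ => (key Y hY Z hZ).1 (h Z hZ)⟩
    · rintro ⟨O, h⟩
      have hY : ((fun a => .occ a (i + 1)) '' O : Set (EncAtom F N S)) ⊆ occSet (i + 1) := by
        rintro _ ⟨a, -, rfl⟩
        exact ⟨a, rfl⟩
      have hO : {a | .occ a (i + 1) ∈ ((fun a => .occ a (i + 1)) '' O :
          Set (EncAtom F N S))} = O := by
        ext a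
        simp
      refine ⟨_, hY, fun Z hZ => (key _ hY Z hZ).2 ?_⟩
      rw [hO]
      exact h Z hZ
  | succ m ih =>
    have key : ∀ Y : Set (EncAtom F N S), Y ⊆ occSet (i + 1) → ∀ Z ⊆ obsSet (i + 1),
        ∀ e X, (HasModel D (P ∪ fixcons Y (occSet (i + 1)) ∪ fixcons Z (obsSet (i + 1)))
          (i + 1 + 1) m e X ↔ HasModel D P (i + 1) (m + 1)
            (scons ({a | .occ a (i + 1) ∈ Y}, .obs (i + 1) ∈ Z) e) X) := by
      intro Y hY Z hZ e X
      simp only [HasModel, isStable_union_fixcons hZ, isStable_union_fixcons hY,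
        inter_occSet_iff hY, inter_obsSet_iff hZ]
      refine exists_congr fun M => ?_
      have h1 : (∀ T ≤ m + 1, ∀ a, .occ a (i + 1 + T) ∈ M ↔
          a ∈ (scons ({a | .occ a (i + 1) ∈ Y}, .obs (i + 1) ∈ Z) e T).1) ↔
          (∀ a, .occ a (i + 1) ∈ M ↔ .occ a (i + 1) ∈ Y) ∧
            ∀ T ≤ m, ∀ a, .occ a (i + 1 + 1 + T) ∈ M ↔ a ∈ (e T).1 := by
        constructor
        · intro h
          refine ⟨h 0 (Nat.zero_le _), fun T hT => ?_⟩
          rw [add_right_comm (i + 1)]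
          exact h (T + 1) (by omega)
        · rintro ⟨h0, h⟩ (_ | T) hT
          · exact h0
          · have := h T (by omega)
            rwa [add_right_comm (i + 1)] at this
      have h2 : (∀ T < m + 1, .obs (i + 1 + T) ∈ M ↔
          (scons ({a | .occ a (i + 1) ∈ Y}, .obs (i + 1) ∈ Z) e T).2) ↔
          (.obs (i + 1) ∈ M ↔ .obs (i + 1) ∈ Z) ∧
            ∀ T < m, .obs (i + 1 + 1 + T) ∈ M ↔ (e T).2 := by
        constructor
        · intro h
          refine ⟨h 0 (Nat.succ_pos _), fun T hT => ?_⟩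
          rw [add_right_comm (i + 1)]
          exact h (T + 1) (by omega)
        · rintro ⟨h0, h⟩ (_ | T) hT
          · exact h0
          · have := h T (by omega)
            rwa [add_right_comm (i + 1)] at this
      rw [h1, h2]
      tauto
    have hidx : i + (m + 1) + 1 = i + 1 + m + 1 := by omega
    simp only [List.range'_succ, List.flatMap_cons, List.cons_append, List.nil_append, QSat, hidx,
      ih, Game]
    constructor
    · rintro ⟨Y, hY, h⟩
      refine ⟨{a | .occ a (i + 1) ∈ Y}, fun b => ?_⟩
      have hZ : {p : EncAtom F N S | p = .obs (i + 1) ∧ b} ⊆ obsSet (i + 1) := fun p hp => hp.1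
      have hb : (.obs (i + 1) ∈ {p : EncAtom F N S | p = .obs (i + 1) ∧ b}) = b :=
        propext (and_iff_right rfl)
      refine (h _ hZ).mono fun e _ he X hX => ?_
      have := (key Y hY _ hZ e X).1 (he X hX)
      rwa [hb] at this
    · rintro ⟨O, h⟩
      have hY : ((fun a => .occ a (i + 1)) '' O : Set (EncAtom F N S)) ⊆ occSet (i + 1) := by
        rintro _ ⟨a, -, rfl⟩
        exact ⟨a, rfl⟩
      have hO : {a | .occ a (i + 1) ∈ ((fun a => .occ a (i + 1)) '' O :
          Set (EncAtom F N S))} = O := by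
        ext a
        simp
      refine ⟨_, hY, fun Z hZ => (h (.obs (i + 1) ∈ Z)).mono fun e _ he X hX =>
        (key _ hY Z hZ e X).2 ?_⟩
      rw [hO]
      exact he X hX

end Planning

open ASP Planning

theorem theorem5 {F N S : Type*} [Finite F] (sensed : S → F)
    (D : Planning.Description F N S) (PP : Planning.Problem F N S)
    (hrep : D.Represents PP) (hGDT : D.init.IsGDT) (n : ℕ) (hn : 0 < n) :
    (∃ p : Planning.Plan N S, p.length ≤ n ∧ PP.Solves sensed p) ↔
      ASP.QSat (Planning.condPrefix D n) (Planning.condProgram sensed D n) := by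
  obtain ⟨hdet, hin, htrans, hinit, hgoal⟩ := hrep
  obtain ⟨m, rfl⟩ := Nat.exists_eq_succ_of_ne_zero hn.ne'
  have hG : PP.goal = {t | ¬ D.goal.Violated t} := hgoal.trans (Set.ext fun _ => mem_goal_iff)
  have hsolves : ∀ p : Plan N S, PP.Solves sensed p ↔
      ∀ s ∈ PP.init, ¬ Mismatch sensed ((∅ : Set (N ⊕ S)), False) s →
        p.Leads sensed (dynTrans D.dyn) {t | ¬ D.goal.Violated t} s := by
    intro p
    have hmis : ∀ s, ¬ Mismatch sensed ((∅ : Set (N ⊕ S)), False) s := fun s ⟨_, ha, _⟩ => ha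
    rw [Problem.Solves, runPlan_iff, htrans, hG]
    simp only [hmis, not_false_eq_true, true_imp_iff]
  simp only [hsolves]
  -- On `Open`, a model is determined by its initial state at the atoms of the choice rules.
  have hopen : ∀ (M Y : Set (EncAtom F N S)), Y ⊆ openSet D → (M ∩ openSet D = Y ↔
      ∀ f, (⟨.choice f, ∅⟩ : Rule F) ∈ D.init → (f ∈ stateAt M 0 ↔ f ∈ stateAt Y 0)) := by
    intro M Y hY
    constructor
    · rintro rfl f hf
      exact ⟨fun h => ⟨h, f, rfl, choice_mem_encInit_iff.2 hf⟩, fun h => h.1⟩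
    · intro h
      ext p
      constructor
      · rintro ⟨hp, f, rfl, hf⟩
        exact (h f (choice_mem_encInit_iff.1 hf)).1 hp
      · intro hp
        obtain ⟨f, rfl, hf⟩ := hY hp
        exact ⟨(h f (choice_mem_encInit_iff.1 hf)).2 hp, f, rfl, hf⟩
  have hpre : condPrefix D (m + 1) = (List.range' 0 m).flatMap
      (fun i => [(Quantifier.ex, occSet (i + 1)), (Quantifier.all, obsSet (i + 1))]) ++
        [(Quantifier.ex, occSet (0 + m + 1)), (Quantifier.all, openSet D)] := by
    rw [condPrefix, List.range_eq_range', Nat.zero_add, Nat.add_sub_cancel]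
  rw [Nat.succ_eq_add_one, hpre, qsat_iff_game, ← game_wins_iff hdet hin]
  refine Game.congr fun e hem => ?_
  -- The sequence of choices is preceded by a time `0` without action and observation.
  have hmodel : ∀ Y ⊆ openSet D, (HasModel D (condProgram sensed D (m + 1)) (0 + 1) m e Y ↔
      ∃ s, (∀ f, (⟨.choice f, ∅⟩ : Rule F) ∈ D.init → (f ∈ s ↔ f ∈ stateAt Y 0)) ∧
        (∀ T ≤ m, (e T).1.Subsingleton) ∧ D.init.IsClosed s ∧ (D.init.Violated s ∨
          Run sensed D {t | ¬ D.goal.Violated t} (m + 1) (scons (∅, False) e) s)) := by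
    intro Y hY
    have hsub : (∀ T ≤ m, (e T).1.Subsingleton) ↔
        ∀ T, 1 ≤ T → T ≤ m + 1 → (scons (∅, False) e T).1.Subsingleton := by
      refine ⟨fun h T h1 h2 => ?_, fun h T hT => h (T + 1) (by omega) (by omega)⟩
      obtain ⟨T, rfl⟩ := Nat.exists_eq_succ_of_ne_zero (by omega : T ≠ 0)
      exact h T (by omega)
    simp only [hsub, ← exists_isStable_iff (e := scons (∅, False) e) (n := m + 1) rfl hem]
    constructor
    · rintro ⟨M, hM, hocc, hobs, hMY⟩
      refine ⟨stateAt M 0, (hopen M Y hY).1 hMY, M, hM, ?_, ?_, rfl⟩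
      · rintro (_ | T) h1 h2
        · omega
        · have := hocc T (by omega)
          rwa [Nat.zero_add, Nat.add_comm 1] at this
      · rintro (_ | T) h1 h2
        · omega
        · have := hobs T (by omega)
          rwa [Nat.zero_add, Nat.add_comm 1] at this
    · rintro ⟨_, hMY, M, hM, hocc, hobs, rfl⟩
      refine ⟨M, hM, fun T hT => ?_, fun T hT => ?_, (hopen M Y hY).2 hMY⟩
      · have := hocc (T + 1) (by omega) (by omega)
        rwa [Nat.zero_add, Nat.add_comm 1]
      · have := hobs (T + 1) (by omega) (by omega)
        rwa [Nat.zero_add, Nat.add_comm 1]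
  have hinit' : ∀ s, s ∈ PP.init ↔ D.init.IsClosed s ∧ ¬ D.init.Violated s := by
    rw [hinit]
    exact fun s => isStable_iff
  constructor
  · rintro ⟨hsub, hrun⟩ Y hY
    obtain ⟨s, ⟨hcl, hs⟩, -⟩ := hGDT.existsUnique (stateAt Y 0)
    exact (hmodel Y hY).2 ⟨s, hs, hsub, hcl, or_iff_not_imp_left.2 fun hv =>
      hrun s ((hinit' s).2 ⟨hcl, hv⟩)⟩
  · intro h
    refine ⟨?_, fun s hs => ?_⟩
    -- Any choice of open atoms has a model, which shows that at most one action is chosen.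
    · obtain ⟨_, _, hsub, _⟩ := (hmodel ∅ (Set.empty_subset _)).1 (h ∅ (Set.empty_subset _))
      exact hsub
    · obtain ⟨hcl, hv⟩ := (hinit' s).1 hs
      -- By uniqueness, `s` is the initial state for the choice of its own open atoms.
      let Y : Set (EncAtom F N S) := {p | ∃ f ∈ s, p = .h f 0 ∧ p ∈ openSet D}
      have hY : Y ⊆ openSet D := fun p ⟨_, _, _, hp⟩ => hp
      have hsY : ∀ f, (⟨.choice f, ∅⟩ : Rule F) ∈ D.init → (f ∈ s ↔ f ∈ stateAt Y 0) := by
        intro f hf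
        constructor
        · exact fun hfs => ⟨f, hfs, rfl, f, rfl, choice_mem_encInit_iff.2 hf⟩
        · rintro ⟨g, hg, hgf, -⟩
          cases hgf
          exact hg
      obtain ⟨s', hs', -, hcl', hrun⟩ := (hmodel Y hY).1 (h Y hY)
      obtain rfl := (hGDT.existsUnique (stateAt Y 0)).unique ⟨hcl', hs'⟩ ⟨hcl, hsY⟩
      exact hrun.resolve_left hv
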